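/- Let $\mathbb{M}$ be a real Banach space with norm $|\cdot|$, equipped with a continuous bilinear skew-symmetric product $[\cdot,\cdot]:\mathbb{M}\times\mathbb{M}\to\mathbb{M}$ satisfying the Jacobi identity, and with closed subspaces $H_1,\dots,H_\iota$ ($\iota\ge 1$) such that the sum map $H_1\times\cdots\times H_\iota\to\mathbb{M}$ is an isomorphism of Banach spaces and, for $x\in H_i$, $y\in H_j$, one has $[x,y]\in H_{i+j}$ if $i+j\le\iota$ and $[x,y]=0$ otherwise. Write $x=x_1+\cdots+x_\iota$ with $x_i\in H_i$. Then $\mathbb{M}$ is a group (a Banach graded nilpotent Lie group) with identity $0$, inverse $x^{-1}=-x$, and operation given by the truncated Baker–Campbell–Hausdorff series $$xy=x+y+\sum_{m=2}^{\iota}P_m(x,y),\qquad P_m(x,y)=\sum\frac{(-1)^{k-1}}{k}\,\frac{m^{-1}}{p_1!q_1!\cdots p_k!q_k!}\;\underbrace{x\circ\cdots\circ x}_{p_1}\circ\underbrace{y\circ\cdots\circ y}_{q_1}\circ\cdots\circ\underbrace{x\circ\cdots\circ x}_{p_k}\circ\underbrace{y\circ\cdots\circ y}_{q_k},$$ where $a_1\circ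 a_2\circ\cdots\circ a_n=[\cdots[[a_1,a_2],a_3]\cdots,a_n]$ and the sum is over all $k\ge1$ and all tuples $(p_1,q_1,\dots,p_k,q_k)$ of nonnegative integers with $p_i+q_i\ge1$ for all $i$ and $\sum_{i=1}^k(p_i+q_i)=m$. Let $\delta_r x=\sum_{i=1}^\iota r^i x_i$ for $r>0$. Let $\sigma_1=1$ and let $\sigma_2,\dots,\sigma_\iota$ be arbitrary positive constants (in particular, they may be chosen so that $\|xy\|\le\|x\|+\|y\|$ below), and put $$\|x\|=\max\{\sigma_i|x_i|^{1/i}:1\le i\le\iota\},\qquad \rho(x,y)=\|x^{-1}y\|.$$ Assume that $H_1$, with the norm $|\cdot|$, has the Radon–Nikodym property: for every finite measure space $(\Omega,\mu)$, every countably additive $H_1$-valued measure $\nu$ on $\Omega$ of bounded variation which is absolutely continuous with respect to $\mu$ has the form $\nu(E)=\int_E g\,d\mu$ for a Bochner integrable $g:\Omega\to H_1$. Let $A\subset\mathbb{R}$ be an arbitrary set and let $\gamma:A\to\mathbb{M}$ be Lipschitz, i.e. there is a constant $C$ with $\rho(\gamma(s),\gamma(t))\le C|s-t|$ for all $s,t\in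 A$. Then $\gamma$ is (Pansu) differentiable at almost every $t\in A$ with respect to Lebesgue (outer) measure $\mathcal{L}^1$. That is, for almost every $t\in A$ the point $t$ is a density point of $A$, meaning $\mathcal{L}^1(A\cap(t-r,t+r))/(2r)\to1$ as $r\to0^+$, and there is a continuous group homomorphism $L:\mathbb{R}\to\mathbb{M}$ with $L(rs)=\delta_rL(s)$ for all $r>0$, $s\in\mathbb{R}$, such that $$\rho\big(\gamma(t)^{-1}\gamma(t+z),L(z)\big)=o(|z|)\qquad\text{as } z\to0,\ t+z\in A.$$ -/

import Mathlib

open MeasureTheory Topology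

noncomputable section

/-- The Radon-Nikodym property of a Banach space `E`: every `E`-valued countably additive vector
measure of bounded variation that is absolutely continuous with respect to a finite positive
measure `μ` has a Bochner integrable density with respect to `μ`. -/
def HasRNP (E : Type*) [NormedAddCommGroup E] [NormedSpace ℝ E] : Prop :=
  ∀ (Ω : Type) [MeasurableSpace Ω] (μ : Measure Ω) [IsFiniteMeasure μ] (ν : VectorMeasure Ω E),
    ν.variation Set.univ < ⊤ →
    (∀ s, MeasurableSet s → μ s = 0 → ν s = 0) →
    ∃ g : Ω → E, Integrable g μ ∧ ∀ s, MeasurableSet s → ν s = ∫ x in s, g x ∂μ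

/-- A Banach homogeneous group (Banach graded nilpotent Lie group): a Banach space `M` with a
continuous Lie product and a gradation `M = H₁ ⊕ ⋯ ⊕ H_ι` into closed subspaces.
`layer i` is `H_i`; it is `0` when `i` is not in `{1, …, ι}`, so that `bracket_mem` says both that
`[H_i, H_j] ⊆ H_{i+j}` when `i + j ≤ ι` and that `[H_i, H_j] = 0` when `i + j > ι`. -/
structure BanachHomogeneousGroup (M : Type*) [NormedAddCommGroup M] [NormedSpace ℝ M] where
  /-- the Lie product -/
  bracket : M →L[ℝ] M →L[ℝ] M
  bracket_skew : ∀ x y, bracket x y = -bracket y x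
  jacobi : ∀ x y z,
    bracket x (bracket y z) + bracket y (bracket z x) + bracket z (bracket x y) = 0
  /-- the number of layers -/
  ι : ℕ
  one_le_ι : 1 ≤ ι
  /-- the layers `H_i` -/
  layer : ℕ → Submodule ℝ M
  isClosed_layer : ∀ i, IsClosed (layer i : Set M)
  layer_eq_bot : ∀ i, i = 0 ∨ ι < i → layer i = ⊥
  bracket_mem : ∀ i j x y, x ∈ layer i → y ∈ layer j → bracket x y ∈ layer (i + j)
  /-- the sum map `H₁ × ⋯ × H_ι → M` is an isomorphism of Banach spaces -/
  sumEquiv : ((i : Fin ι) → layer (i + 1)) ≃L[ℝ] M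
  sumEquiv_apply : ∀ v, sumEquiv v = ∑ i, (v i : M)

namespace BanachHomogeneousGroup

variable {M : Type*} [NormedAddCommGroup M] [NormedSpace ℝ M] (G : BanachHomogeneousGroup M)

/-- The component `x_{i+1} = π_{i+1}(x)` of `x` in `H_{i+1}`, where `0 ≤ i < ι`. -/
def comp (i : Fin G.ι) (x : M) : M := (G.sumEquiv.symm x i : M)

/-- The dilation `δ_r x = r x₁ + r² x₂ + ⋯ + r^ι x_ι`. -/
def dil (r : ℝ) (x : M) : M := ∑ i : Fin G.ι, r ^ (i.val + 1) • G.comp i x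

/-- The left-normed iterated product `a₁ ∘ a₂ ∘ ⋯ ∘ a_k = [⋯[[a₁, a₂], a₃], ⋯, a_k]`. -/
def leftNormed : List M → M
  | [] => 0
  | a :: l => l.foldl (fun u v => G.bracket u v) a

/-- The word `x⋯x y⋯y ⋯ x⋯x y⋯y` with `p_1, q_1, …, p_k, q_k` repetitions,
where `(p_i, q_i)` is the pair `w i`. -/
def dynkinWord {k : ℕ} (w : Fin k → ℕ × ℕ) (x y : M) : List M :=
  (List.ofFn fun i => List.replicate (w i).1 x ++ List.replicate (w i).2 y).flatten

/-- The `2k`-tuples `(p_1, q_1, …, p_k, q_k)` of natural numbers with `p_i + q_i ≥ 1` for all `i`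
and `∑ (p_i + q_i) = m`. -/
def dynkinIndex (m k : ℕ) : Finset (Fin k → ℕ × ℕ) :=
  (Fintype.piFinset fun _ => Finset.range (m + 1) ×ˢ Finset.range (m + 1)).filter
    fun w => (∀ i, 1 ≤ (w i).1 + (w i).2) ∧ ∑ i, ((w i).1 + (w i).2) = m

/-- The Dynkin polynomial `P_m(x, y)`. As `p_i + q_i ≥ 1`, only `1 ≤ k ≤ m` occurs. -/
def dynkin (m : ℕ) (x y : M) : M :=
  ∑ k ∈ Finset.Icc 1 m, ∑ w ∈ dynkinIndex m k,
    ((-1 : ℝ) ^ (k - 1) / k * ((m : ℝ)⁻¹ / ∏ i, ((w i).1.factorial * (w i).2.factorial : ℝ))) •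
      G.leftNormed (dynkinWord w x y)

/-- The group operation, that is, the truncated Baker-Campbell-Hausdorff series
`x y = x + y + ∑_{m ≥ 2} P_m(x, y)`. All products of more than `ι` factors vanish, hence the terms
with `m > ι` are zero. -/
def mul (x y : M) : M := x + y + ∑ m ∈ Finset.Icc 2 G.ι, G.dynkin m x y

/-- The homogeneous norm `‖x‖ = max { σ_i |x_i|^{1/i} : 1 ≤ i ≤ ι }`. -/
def hnorm (σ : ℕ → ℝ) (x : M) : ℝ :=
  ⨆ i : Fin G.ι, σ (i + 1) * ‖G.comp i x‖ ^ (1 / ((i : ℝ) + 1))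

/-- The homogeneous distance `ρ(x, y) = ‖x⁻¹ y‖`, where the group inverse of `x` is `-x`. -/
def rho (σ : ℕ → ℝ) (x y : M) : ℝ := G.hnorm σ (G.mul (-x) y)

/-- `L : ℝ → M` is a homogeneous homomorphism: a continuous group homomorphism that commutes with
dilations (the dilations of `ℝ` are `t ↦ r t`). -/
structure IsHHom (L : ℝ → M) : Prop where
  continuous : Continuous L
  map_add : ∀ s t, L (s + t) = G.mul (L s) (L t)
  map_dil : ∀ r t, 0 < r → L (r * t) = G.dil r (L t)

end BanachHomogeneousGroup

/-- `t` is a density point of the (not necessarily measurable) set `A ⊆ ℝ`, with respect to the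
Lebesgue outer measure. -/
def IsDensityPoint (A : Set ℝ) (t : ℝ) : Prop :=
  Filter.Tendsto (fun r => volume (A ∩ Metric.ball t r) / volume (Metric.ball t r))
    (𝓝[>] 0) (𝓝 1)

namespace BanachHomogeneousGroup

variable {M : Type*} [NormedAddCommGroup M] [NormedSpace ℝ M] (G : BanachHomogeneousGroup M)

/-- The curve `γ : A → M` is (Pansu) differentiable at `t`: `t ∈ A` is a density point of `A` and
there is a homogeneous homomorphism `L` with `ρ(γ(t)⁻¹ γ(t + z), L(z)) = o(|z|)` as `z → 0` with
`t + z ∈ A`. Only the values of `γ` on `A` matter. -/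
def PansuDifferentiableAt (σ : ℕ → ℝ) (A : Set ℝ) (γ : ℝ → M) (t : ℝ) : Prop :=
  t ∈ A ∧ IsDensityPoint A t ∧ ∃ L : ℝ → M, G.IsHHom L ∧
    (fun z => G.rho σ (G.mul (-γ t) (γ (t + z))) (L z)) =o[𝓝[{z | t + z ∈ A}] 0] fun z => z

end BanachHomogeneousGroup

end

/-!
The first layer of `γ` is an ordinary Lipschitz map into `H₁`, so that the Radon-Nikodym property
makes it differentiable almost everywhere, within the domain `A`; almost every point of `A` is a
density point of `A`. At a density point `t` where the first layer has the derivative `v`, the curve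
is Pansu differentiable, with `L z = z v`.

To see this, let `g = γ(t)⁻¹ γ(t + z)` and join `t` to `t + z` by `N` almost equidistant
points `s_j` of `A`. Then `g` is the product of the increments `γ(s_j)⁻¹ γ(s_{j+1})`. After the dilation
`δ_{1/z}`, the component of an increment in layer `i` is `O(N^{-i})`, while its first component is
`v / N` up to an error which tends to `0` with `z`. Hence the layers above the first one contribute
only `N · O(N^{-2})` to the product, and `δ_{1/z} g` tends to `v`: see `norm_expRep_blowup_sub_le`
and `pansuDifferentiableAt_of_hasDerivWithinAt`.

This argument takes place in the group `M`, so the group laws must be deduced from the explicit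
Dynkin series. The Lie algebra `M` has a derivation, the Euler derivation `x ↦ ∑ i x_i`, which is
injective; therefore the adjoint representation of its semidirect product with `M` is faithful on
`M`. It gives a nilpotent representation `rep` of `M` on `M × ℝ`, and `expRep_mul` states that
`exp ∘ rep` is multiplicative. Associativity follows, and so do the estimates for long products,
which are carried out for products of exponentials in a Banach algebra.

`expRep_mul` is an instance of Dynkin's formula `nlog_nexp_mul_nexp` in a nilpotent associative
algebra `B`. Let `Z(t)` be the logarithm of `exp (t x) exp (t y)`, a polynomial over `B`. For
operators on `B[t]` put `r_a(u) = u a - a u`. Since `exp r_a` is the conjugation by `exp a`, the operator `r_Z`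
is the logarithm of `exp r_{ty} exp r_{tx}`. Applied to `u = d/dt`, the left-hand side is `Z'`, and
the words in `r_{tx}` and `r_{ty}` on the right-hand side are left-normed commutators.

Lipschitz maps into a space with the Radon-Nikodym property are treated by extending them from `A`
to the line, by linear interpolation, and by representing their increments by a vector measure.
-/

noncomputable section

/-! ### Exponential and logarithm of nilpotent elements -/

section NilpotentExpLog

namespace PowerSeries

/-- `log (1 + (exp X - 1)) = X`. -/
theorem log_subst_exp_sub_one : (log ℝ).subst (exp ℝ - 1) = (X : ℝ⟦X⟧) := by
  have hs : HasSubst (exp ℝ - 1) := HasSubst.exp_sub_one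
  apply derivative.ext
  · rw [derivative_subst hs, deriv_log, derivative_X]
    have h1 : (mk fun n ↦ algebraMap ℚ ℝ ((-1 : ℚ) ^ n)) * (1 + X) = (1 : ℝ⟦X⟧) := by
      ext n
      rcases n with _ | n
      · simp
      · simp [mul_add, coeff_succ_mul_X, pow_succ, coeff_one]
    have h2 := congrArg (subst (exp ℝ - 1)) h1
    rw [subst_mul hs, subst_add hs, subst_X hs] at h2
    have h3 : (1 : ℝ⟦X⟧).subst (exp ℝ - 1) = (1 : ℝ⟦X⟧) := by
      rw [← coe_substAlgHom hs, map_one]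
    rw [h3] at h2
    have h4 : d⁄dX ℝ (exp ℝ - 1) = exp ℝ := by
      rw [map_sub, derivative_exp, derivative_one, sub_zero]
    rw [h4]
    simpa using h2
  · have h := constantCoeff_subst_eq_zero (a := (exp ℝ - 1 : ℝ⟦X⟧))
      (by show constantCoeff (exp ℝ - 1) = 0; simp) (log ℝ) constantCoeff_log
    rw [constantCoeff_X]
    exact h

/-- `exp (log (1 + X)) - 1 = X`. -/
theorem exp_sub_one_subst_log : (exp ℝ - 1).subst (log ℝ) = (X : ℝ⟦X⟧) := by
  have h0 : constantCoeff (exp ℝ - 1 : ℝ⟦X⟧) = 0 := by simp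
  have h1 : coeff 1 (exp ℝ - 1 : ℝ⟦X⟧) = 1 := by simp [coeff_one]
  have : Invertible (coeff 1 (exp ℝ - 1 : ℝ⟦X⟧)) := by rw [h1]; exact invertibleOne
  have hP : HasSubst (exp ℝ - 1) := HasSubst.exp_sub_one
  have hQ : HasSubst (exp ℝ - 1 : ℝ⟦X⟧).substInv := HasSubst.substInv _
  have h2 := subst_substInv_right (exp ℝ - 1 : ℝ⟦X⟧) h0
  have h3 := congrArg (subst (exp ℝ - 1 : ℝ⟦X⟧).substInv) log_subst_exp_sub_one
  rw [subst_comp_subst_apply hP hQ, h2, subst_X hQ, X_subst] at h3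
  rw [h3, h2]

end PowerSeries

variable {B : Type*} [Ring B] [Algebra ℝ B]

/-- The exponential series truncated after `n` terms; it is the exponential of `a` when
`a ^ n = 0`. -/
def nexp (n : ℕ) (a : B) : B := ∑ k ∈ Finset.range n, ((k.factorial : ℝ)⁻¹) • a ^ k

/-- The logarithmic series `∑ (-1)^(k-1) / k (u - 1)^k` truncated after `n` terms; it is the
logarithm of `u` when `(u - 1) ^ n = 0`. The term `k = 0` vanishes because of the division by
zero in its coefficient. -/
def nlog (n : ℕ) (u : B) : B :=
  ∑ k ∈ Finset.range n, ((-1 : ℝ) ^ (k - 1) / k) • (u - 1) ^ k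

namespace PowerSeries

/-- Evaluation of a power series at an element `a` with `a ^ n = 0`. -/
def nilEval (n : ℕ) (a : B) (f : ℝ⟦X⟧) : B := Polynomial.aeval a (trunc n f)

theorem nilEval_eq_sum (n : ℕ) (a : B) (f : ℝ⟦X⟧) :
    nilEval n a f = ∑ k ∈ Finset.range n, coeff k f • a ^ k := by
  rw [nilEval, Polynomial.aeval_def, eval₂_trunc_eq_sum_range]
  simp [Algebra.smul_def]

theorem nilEval_coe {n : ℕ} {a : B} (ha : a ^ n = 0) (p : Polynomial ℝ) :
    nilEval n a (p : ℝ⟦X⟧) = Polynomial.aeval a p := by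
  rw [nilEval_eq_sum, Polynomial.aeval_eq_sum_range' (n := max n (p.natDegree + 1)) (by simp)]
  rw [← Finset.sum_subset (Finset.range_subset_range.2 (le_max_left _ _))]
  · simp
  · intro k _ hk
    rw [pow_eq_zero_of_le (by simpa using hk) ha, smul_zero]

theorem nilEval_mul {n : ℕ} {a : B} (ha : a ^ n = 0) (f g : ℝ⟦X⟧) :
    nilEval n a (f * g) = nilEval n a f * nilEval n a g := by
  rw [nilEval, ← trunc_trunc_mul_trunc, ← Polynomial.coe_mul]
  change nilEval n a _ = _
  rw [nilEval_coe ha, map_mul]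
  rfl

theorem nilEval_add (n : ℕ) (a : B) (f g : ℝ⟦X⟧) :
    nilEval n a (f + g) = nilEval n a f + nilEval n a g := by
  simp [nilEval]

theorem nilEval_one {n : ℕ} {a : B} (ha : a ^ n = 0) : nilEval n a 1 = 1 := by
  have := nilEval_coe ha 1
  simpa using this

theorem nilEval_X {n : ℕ} {a : B} (ha : a ^ n = 0) : nilEval n a X = a := by
  have := nilEval_coe ha Polynomial.X
  simpa using this

theorem nilEval_pow {n : ℕ} {a : B} (ha : a ^ n = 0) (f : ℝ⟦X⟧) (k : ℕ) :
    nilEval n a (f ^ k) = nilEval n a f ^ k := by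
  induction k with
  | zero => simp [nilEval_one ha]
  | succ k ih => rw [pow_succ, nilEval_mul ha, ih, pow_succ]

theorem nilEval_pow_eq_zero {n : ℕ} {a : B} (ha : a ^ n = 0) {f : ℝ⟦X⟧}
    (hf : constantCoeff f = 0) : nilEval n a f ^ n = 0 := by
  obtain ⟨h, rfl⟩ := X_dvd_iff.2 hf
  rw [← nilEval_pow ha, mul_pow, nilEval_mul ha, nilEval_pow ha, nilEval_X ha, ha, zero_mul]

theorem nilEval_subst {n : ℕ} {a : B} (ha : a ^ n = 0) {g : ℝ⟦X⟧} (hg : constantCoeff g = 0)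
    (f : ℝ⟦X⟧) : nilEval n a (f.subst g) = nilEval n (nilEval n a g) f := by
  have hs : HasSubst g := HasSubst.of_constantCoeff_zero' hg
  conv_lhs => rw [eq_X_pow_mul_shift_add_trunc n f]
  rw [subst_add hs, subst_mul hs, subst_pow hs, subst_X hs, subst_coe hs, nilEval_add,
    nilEval_mul ha, nilEval_pow ha, nilEval_pow_eq_zero ha hg, zero_mul, zero_add]
  change _ = Polynomial.aeval _ (trunc n f)
  rw [Polynomial.aeval_eq_sum_range, Polynomial.aeval_eq_sum_range]
  generalize (trunc n f).natDegree + 1 = m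
  have hsum : ∀ s : Finset ℕ, nilEval n a (∑ k ∈ s, (trunc n f).coeff k • g ^ k) =
      ∑ k ∈ s, (trunc n f).coeff k • nilEval n a g ^ k := by
    intro s
    induction s using Finset.induction_on with
    | empty => simp [nilEval]
    | insert i s hi ih =>
      rw [Finset.sum_insert hi, Finset.sum_insert hi, nilEval_add, ih, ← nilEval_pow ha]
      congr 1
      simp [nilEval_eq_sum, Finset.smul_sum, smul_smul]
  exact hsum _

end PowerSeries

open PowerSeries in
theorem nexp_eq_nilEval (n : ℕ) (a : B) : nexp n a = nilEval n a (exp ℝ) := by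
  simp [nexp, nilEval_eq_sum, coeff_exp]

open PowerSeries in
theorem nexp_sub_one_eq_nilEval {n : ℕ} {a : B} (ha : a ^ n = 0) :
    nexp n a - 1 = nilEval n a (exp ℝ - 1) := by
  rw [sub_eq_iff_eq_add, ← nilEval_one ha, ← nilEval_add, sub_add_cancel, nexp_eq_nilEval]

open PowerSeries in
theorem nlog_eq_nilEval (n : ℕ) (u : B) : nlog n u = nilEval n (u - 1) (log ℝ) := by
  rw [nlog, nilEval_eq_sum]
  refine Finset.sum_congr rfl fun k _ ↦ ?_
  rcases k with _ | k
  · simp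
  · simp [pow_succ]

theorem nlog_pow {n : ℕ} {u : B} (hu : (u - 1) ^ n = 0) : nlog n u ^ n = 0 := by
  rw [nlog_eq_nilEval]
  exact PowerSeries.nilEval_pow_eq_zero hu (by simp)

theorem nlog_nexp {n : ℕ} {a : B} (ha : a ^ n = 0) : nlog n (nexp n a) = a := by
  rw [nlog_eq_nilEval, nexp_sub_one_eq_nilEval ha, ← PowerSeries.nilEval_subst ha (by simp),
    PowerSeries.log_subst_exp_sub_one, PowerSeries.nilEval_X ha]

theorem nexp_nlog {n : ℕ} {u : B} (hu : (u - 1) ^ n = 0) : nexp n (nlog n u) = u := by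
  rw [← sub_left_inj (a := 1), nexp_sub_one_eq_nilEval (nlog_pow hu), nlog_eq_nilEval,
    ← PowerSeries.nilEval_subst hu (by simp), PowerSeries.exp_sub_one_subst_log,
    PowerSeries.nilEval_X hu]

theorem nexp_eq_of_le {m n : ℕ} (h : m ≤ n) {a : B} (ha : a ^ m = 0) : nexp n a = nexp m a := by
  rw [nexp, nexp, ← Finset.sum_subset (Finset.range_subset_range.2 h)]
  intro k _ hk
  rw [pow_eq_zero_of_le (by simpa using hk) ha, smul_zero]

theorem nexp_eq_isNilpotent_exp [Module ℚ B] {n : ℕ} {a : B} (ha : a ^ n = 0) :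
    nexp n a = IsNilpotent.exp a := by
  rw [IsNilpotent.exp_eq_sum ha, nexp]
  refine Finset.sum_congr rfl fun k _ ↦ ?_
  have := (Rat.cast_smul_eq_qsmul ℝ ((k.factorial : ℚ)⁻¹) (a ^ k))
  rw [← this]
  simp

theorem nexp_add {n : ℕ} {a b : B} (hab : Commute a b) (ha : a ^ n = 0) (hb : b ^ n = 0)
    (h : (a + b) ^ n = 0) : nexp n (a + b) = nexp n a * nexp n b := by
  let _ : Module ℚ B := Module.compHom B (algebraMap ℚ ℝ)
  rw [nexp_eq_isNilpotent_exp ha, nexp_eq_isNilpotent_exp hb, nexp_eq_isNilpotent_exp h]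
  exact IsNilpotent.exp_add_of_commute hab ⟨n, ha⟩ ⟨n, hb⟩

theorem nexp_zero {n : ℕ} (hn : n ≠ 0) : nexp n (0 : B) = 1 := by
  obtain ⟨m, rfl⟩ := Nat.exists_eq_succ_of_ne_zero hn
  rw [nexp, Finset.sum_range_succ']
  simp

theorem nexp_mul_nexp_neg {n : ℕ} {a : B} (ha : a ^ n = 0) : nexp n a * nexp n (-a) = 1 := by
  rcases eq_or_ne n 0 with rfl | hn
  · exact eq_of_zero_eq_one (by simpa using ha.symm) _ _
  · rw [← nexp_add (Commute.neg_right rfl) ha (by rw [neg_pow, ha, mul_zero])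
      (by simp [zero_pow hn]), add_neg_cancel, nexp_zero hn]

theorem map_nexp {B' : Type*} [Ring B'] [Algebra ℝ B'] (f : B →ₐ[ℝ] B') (n : ℕ) (a : B) :
    f (nexp n a) = nexp n (f a) := by
  simp [nexp]

theorem map_nlog {B' : Type*} [Ring B'] [Algebra ℝ B'] (f : B →ₐ[ℝ] B') (n : ℕ) (a : B) :
    f (nlog n a) = nlog n (f a) := by
  simp [nlog]

end NilpotentExpLog

/-! ### Dynkin words and conjugation by exponentials -/

section Dynkin

/-- The right adjoint action `u ↦ u z - z u`. -/
def adR {S : Type*} [Ring S] [Algebra ℝ S] (z : S) : Module.End ℝ S :=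
  LinearMap.mulRight ℝ z - LinearMap.mulLeft ℝ z

theorem adR_apply {S : Type*} [Ring S] [Algebra ℝ S] (z u : S) : adR z u = u * z - z * u := rfl

section Conj

variable {S : Type*} [Ring S] [Algebra ℝ S]

theorem nexp_mulLeft (n : ℕ) (z : S) :
    nexp n (LinearMap.mulLeft ℝ z) = LinearMap.mulLeft ℝ (nexp n z) := by
  ext u
  simp [nexp, LinearMap.pow_mulLeft, LinearMap.sum_apply, Finset.sum_mul]

theorem nexp_mulRight (n : ℕ) (z : S) :
    nexp n (LinearMap.mulRight ℝ z) = LinearMap.mulRight ℝ (nexp n z) := by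
  ext u
  simp [nexp, LinearMap.pow_mulRight, LinearMap.sum_apply, Finset.mul_sum]

theorem adR_eq_add (z : S) : adR z = LinearMap.mulRight ℝ z + LinearMap.mulLeft ℝ (-z) := by
  ext u; simp [adR_apply, sub_eq_add_neg]

theorem adR_pow {n : ℕ} {z : S} (hz : z ^ n = 0) : adR z ^ (2 * n) = 0 := by
  rcases eq_or_ne n 0 with rfl | hn
  · have : (1 : S) = 0 := by simpa using hz
    ext u
    simpa using congrArg (u * ·) this
  rw [adR_eq_add]
  refine Commute.add_pow_eq_zero_of_add_le_succ_of_pow_eq_zero (m := n) (n := n)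
    (LinearMap.commute_mulLeft_right (-z) z).symm ?_ ?_ (by omega)
  · rw [LinearMap.pow_mulRight, hz, LinearMap.mulRight_zero_eq_zero]
  · rw [LinearMap.pow_mulLeft, neg_pow, hz, mul_zero, LinearMap.mulLeft_zero_eq_zero]

/-- The exponential of the right adjoint action is conjugation by the exponential. -/
theorem nexp_adR_apply {n : ℕ} {z : S} (hz : z ^ n = 0) (u : S) :
    nexp (2 * n) (adR z) u = nexp n (-z) * u * nexp n z := by
  have hz' : (-z) ^ n = 0 := by rw [neg_pow, hz, mul_zero]
  have hle : n ≤ 2 * n := by omega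
  have hp := adR_pow hz
  rw [adR_eq_add] at hp ⊢
  rw [nexp_add (LinearMap.commute_mulLeft_right (-z) z).symm
    (by rw [LinearMap.pow_mulRight, pow_eq_zero_of_le hle hz, LinearMap.mulRight_zero_eq_zero])
    (by rw [LinearMap.pow_mulLeft, pow_eq_zero_of_le hle hz', LinearMap.mulLeft_zero_eq_zero]) hp,
    nexp_mulLeft, nexp_mulRight, nexp_eq_of_le hle hz, nexp_eq_of_le hle hz']
  simp

/-- If `exp z = exp x * exp y`, then the right adjoint action of `z` is the logarithm of the product
of the exponentials of those of `x` and `y`. -/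
theorem adR_eq_nlog {n : ℕ} {x y z : S} (hx : x ^ n = 0) (hy : y ^ n = 0) (hz : z ^ n = 0)
    (h : nexp n z = nexp n x * nexp n y) :
    adR z = nlog (2 * n) (nexp (2 * n) (adR y) * nexp (2 * n) (adR x)) := by
  have h1 : nexp n (-z) = nexp n (-y) * nexp n (-x) := by
    have hz' : (-z) ^ n = 0 := by rw [neg_pow, hz, mul_zero]
    have e1 : nexp n (-z) * nexp n z = 1 := by simpa using nexp_mul_nexp_neg hz'
    have e2 : nexp n z * (nexp n (-y) * nexp n (-x)) = 1 := by
      rw [h, mul_assoc, ← mul_assoc (nexp n y), nexp_mul_nexp_neg hy, one_mul,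
        nexp_mul_nexp_neg hx]
    exact left_inv_eq_right_inv e1 e2
  have h2 : nexp (2 * n) (adR y) * nexp (2 * n) (adR x) = nexp (2 * n) (adR z) := by
    ext u
    rw [Module.End.mul_apply, nexp_adR_apply hx, nexp_adR_apply hy, nexp_adR_apply hz, h1, h]
    simp only [mul_assoc]
  rw [h2, nlog_nexp (adR_pow hz)]

end Conj

section Words

/-- The word `x⋯x y⋯y ⋯ x⋯x y⋯y` with the multiplicities given by `w`. -/
def blockWord {W : Type*} {k : ℕ} (w : Fin k → ℕ × ℕ) (x y : W) : List W :=
  (List.ofFn fun i => List.replicate (w i).1 x ++ List.replicate (w i).2 y).flatten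

theorem blockWord_zero {W : Type*} (w : Fin 0 → ℕ × ℕ) (x y : W) : blockWord w x y = [] := by
  simp [blockWord]

theorem blockWord_succ {W : Type*} {k : ℕ} (w : Fin (k + 1) → ℕ × ℕ) (x y : W) :
    blockWord w x y = blockWord (Fin.init w) x y ++
      (List.replicate (w (Fin.last k)).1 x ++ List.replicate (w (Fin.last k)).2 y) := by
  simp only [blockWord]
  rw [List.ofFn_succ', List.concat_eq_append, List.flatten_append]
  simp [Fin.init]

theorem map_blockWord {W W' : Type*} (f : W → W') {k : ℕ} (w : Fin k → ℕ × ℕ) (x y : W) :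
    (blockWord w x y).map f = blockWord w (f x) (f y) := by
  induction k with
  | zero => simp [blockWord_zero]
  | succ k ih => rw [blockWord_succ, List.map_append, ih, blockWord_succ]; simp

theorem length_blockWord {W : Type*} {k : ℕ} (w : Fin k → ℕ × ℕ) (x y : W) :
    (blockWord w x y).length = ∑ i, ((w i).1 + (w i).2) := by
  induction k with
  | zero => simp [blockWord_zero]
  | succ k ih => rw [blockWord_succ, List.length_append, ih, Fin.sum_univ_castSucc]; simp [Fin.init]

theorem mem_blockWord {W : Type*} {k : ℕ} {w : Fin k → ℕ × ℕ} {x y a : W}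
    (h : a ∈ blockWord w x y) : a = x ∨ a = y := by
  simp only [blockWord, List.mem_flatten, List.mem_ofFn] at h
  obtain ⟨l, ⟨i, rfl⟩, hl⟩ := h
  rcases List.mem_append.1 hl with h | h
  · exact Or.inl (List.eq_of_mem_replicate h)
  · exact Or.inr (List.eq_of_mem_replicate h)

/-- The pairs `(p, q)` of natural numbers less than `N` with `p + q ≥ 1`. -/
def expIndex (N : ℕ) : Finset (ℕ × ℕ) :=
  (Finset.range N ×ˢ Finset.range N).filter fun a => 1 ≤ a.1 + a.2

variable {W : Type*} [AddCommGroup W] [Module ℝ W]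

theorem foldl_apply_replicate (P : Module.End ℝ W) (p : ℕ) (u : W) :
    (List.replicate p P).foldl (fun u f => f u) u = (P ^ p) u := by
  induction p generalizing u with
  | zero => simp
  | succ p ih => rw [List.replicate_succ, List.foldl_cons, ih, pow_succ, Module.End.mul_apply]

theorem foldl_apply_sum {α : Type*} (l : List (Module.End ℝ W)) (s : Finset α) (c : α → ℝ)
    (f : α → W) : l.foldl (fun u g => g u) (∑ a ∈ s, c a • f a) =
      ∑ a ∈ s, c a • l.foldl (fun u g => g u) (f a) := by
  induction l generalizing f with
  | nil => simp
  | cons g l ih => simp only [List.foldl_cons, map_sum, map_smul]; exact ih _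

theorem exp_mul_exp_sub_one_apply {N : ℕ} (hN : N ≠ 0) (P Q : Module.End ℝ W) (u : W) :
    (nexp N Q * nexp N P - 1) u = ∑ a ∈ expIndex N,
      ((a.1.factorial * a.2.factorial : ℝ)⁻¹) •
        (List.replicate a.1 P ++ List.replicate a.2 Q).foldl (fun u f => f u) u := by
  have h1 : (nexp N Q * nexp N P) u = ∑ a ∈ Finset.range N ×ˢ Finset.range N,
      ((a.1.factorial * a.2.factorial : ℝ)⁻¹) • (Q ^ a.2) ((P ^ a.1) u) := by
    simp only [nexp, Module.End.mul_apply, LinearMap.sum_apply, LinearMap.smul_apply]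
    rw [Finset.sum_product_right]
    refine Finset.sum_congr rfl fun q _ ↦ ?_
    rw [map_sum, Finset.smul_sum]
    refine Finset.sum_congr rfl fun p _ ↦ ?_
    rw [map_smul, smul_smul, mul_inv_rev]
  rw [LinearMap.sub_apply, h1, ← Finset.sum_filter_add_sum_filter_not _
    (fun a : ℕ × ℕ ↦ 1 ≤ a.1 + a.2)]
  have h2 : (Finset.range N ×ˢ Finset.range N).filter (fun a : ℕ × ℕ ↦ ¬ 1 ≤ a.1 + a.2)
      = {(0, 0)} := by
    ext ⟨p, q⟩
    simp
    omega
  rw [h2]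
  simp [List.foldl_append, foldl_apply_replicate, expIndex]

theorem sum_piFinset_snoc {α A : Type*} [AddCommMonoid A] [DecidableEq α] {k : ℕ} (s : Finset α)
    (f : (Fin (k + 1) → α) → A) :
    ∑ w ∈ Fintype.piFinset (fun _ : Fin (k + 1) ↦ s), f w =
      ∑ a ∈ s, ∑ w ∈ Fintype.piFinset (fun _ : Fin k ↦ s), f (Fin.snoc w a) := by
  rw [← Finset.sum_product']
  refine Finset.sum_nbij' (fun w ↦ (w (Fin.last k), Fin.init w)) (fun p ↦ Fin.snoc p.2 p.1)
    ?_ ?_ ?_ ?_ ?_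
  · intro w hw
    simp only [Fintype.mem_piFinset, Finset.mem_product] at hw ⊢
    exact ⟨hw _, fun i ↦ hw _⟩
  · rintro ⟨a, w⟩ h
    simp only [Fintype.mem_piFinset, Finset.mem_product] at h ⊢
    intro i
    refine Fin.lastCases ?_ (fun j ↦ ?_) i
    · simpa using h.1
    · simpa using h.2 j
  · intro w _; simp
  · rintro ⟨a, w⟩ _; simp
  · intro w _; simp

/-- Expansion of `(exp Q exp P - 1) ^ k` into words. -/
theorem exp_mul_exp_sub_one_pow_apply {N : ℕ} (hN : N ≠ 0) (P Q : Module.End ℝ W) (k : ℕ) (u : W) :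
    ((nexp N Q * nexp N P - 1) ^ k) u = ∑ w ∈ Fintype.piFinset (fun _ : Fin k ↦ expIndex N),
      ((∏ i, ((w i).1.factorial * (w i).2.factorial : ℝ))⁻¹) •
        (blockWord w P Q).foldl (fun u f => f u) u := by
  induction k with
  | zero => simp [blockWord_zero]
  | succ k ih =>
    rw [pow_succ', Module.End.mul_apply, ih, exp_mul_exp_sub_one_apply hN, sum_piFinset_snoc]
    refine Finset.sum_congr rfl fun a _ ↦ ?_
    rw [foldl_apply_sum, Finset.smul_sum]
    refine Finset.sum_congr rfl fun w _ ↦ ?_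
    rw [blockWord_succ, Fin.init_snoc, Fin.snoc_last, List.foldl_append, smul_smul,
      Fin.prod_univ_castSucc]
    simp [mul_comm]

end Words

end Dynkin

/-! ### Dynkin's formula in a nilpotent associative algebra -/

section DynkinFormula

section Ideal

variable {B : Type*} [Ring B] [Algebra ℝ B] {J : Submodule ℝ B}

theorem pow_succ_mem_of_mul_le (hJ : J * J ≤ J) {a : B} (ha : a ∈ J) (k : ℕ) : a ^ (k + 1) ∈ J := by
  induction k with
  | zero => simpa using ha
  | succ k ih => rw [pow_succ]; exact hJ (Submodule.mul_mem_mul ih ha)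

theorem pow_succ_le_of_mul_le (R : ℕ → Submodule ℝ B) (h : ∀ i j, R i * R j ≤ R (i + j)) (m : ℕ) :
    R 1 ^ (m + 1) ≤ R (m + 1) := by
  induction m with
  | zero => simp
  | succ m ih =>
    rw [pow_succ]
    exact (mul_le_mul' ih le_rfl).trans (h _ _)

theorem nexp_sub_one_mem (hJ : J * J ≤ J) {n : ℕ} (hn : n ≠ 0) {a : B} (ha : a ∈ J) :
    nexp n a - 1 ∈ J := by
  obtain ⟨m, rfl⟩ := Nat.exists_eq_succ_of_ne_zero hn
  rw [nexp, Finset.sum_range_succ']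
  simp only [Nat.factorial_zero, Nat.cast_one, inv_one, pow_zero, one_smul, add_sub_cancel_right]
  exact J.sum_mem fun k _ ↦ J.smul_mem _ (pow_succ_mem_of_mul_le hJ ha k)

theorem nexp_mul_nexp_sub_one_mem (hJ : J * J ≤ J) {n : ℕ} (hn : n ≠ 0) {a b : B} (ha : a ∈ J)
    (hb : b ∈ J) : nexp n a * nexp n b - 1 ∈ J := by
  have h : nexp n a * nexp n b - 1 =
      (nexp n a - 1) * (nexp n b - 1) + (nexp n a - 1) + (nexp n b - 1) := by noncomm_ring
  rw [h]
  have h1 := nexp_sub_one_mem hJ hn ha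
  have h2 := nexp_sub_one_mem hJ hn hb
  exact J.add_mem (J.add_mem (hJ (Submodule.mul_mem_mul h1 h2)) h1) h2

theorem pow_eq_zero_of_mem {n : ℕ} (h : J ^ n = ⊥) {a : B} (ha : a ∈ J) : a ^ n = 0 := by
  have := Submodule.pow_mem_pow J ha n
  rwa [h, Submodule.mem_bot] at this

/-- The left-normed iterated commutator of a word. -/
def commWord : List B → B
  | [] => 0
  | a :: l => l.foldl (fun u v => u * v - v * u) a

theorem foldl_commutator_mem {m : ℕ} {u : B} (hu : u ∈ J ^ m) (l : List B) (hl : ∀ a ∈ l, a ∈ J) :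
    l.foldl (fun u v => u * v - v * u) u ∈ J ^ (m + l.length) := by
  induction l generalizing u m with
  | nil => simpa using hu
  | cons a l ih =>
    rw [List.foldl_cons, List.length_cons, add_comm l.length, ← add_assoc]
    have ha := hl a (by simp)
    refine ih (Submodule.sub_mem _ ?_ ?_) fun b hb ↦ hl b (by simp [hb])
    · rw [pow_succ]; exact Submodule.mul_mem_mul hu ha
    · rw [pow_succ']; exact Submodule.mul_mem_mul ha hu

theorem commWord_mem (l : List B) (hl : ∀ a ∈ l, a ∈ J) : commWord l ∈ J ^ l.length := by
  cases l with
  | nil => exact Submodule.zero_mem _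
  | cons a l =>
    have := foldl_commutator_mem (m := 1) (by simpa using hl a (by simp)) l
      fun b hb ↦ hl b (by simp [hb])
    rwa [add_comm] at this

/-- The polynomials with coefficients in a submodule. -/
def polyCoeffs (J : Submodule ℝ B) : Submodule ℝ (Polynomial B) where
  carrier := {p | ∀ k, p.coeff k ∈ J}
  add_mem' hp hq k := by simpa using J.add_mem (hp k) (hq k)
  zero_mem' k := by simp
  smul_mem' c p hp k := by simpa using J.smul_mem c (hp k)

theorem polyCoeffs_mul_le (J K : Submodule ℝ B) :
    polyCoeffs J * polyCoeffs K ≤ polyCoeffs (J * K) := by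
  rw [Submodule.mul_le]
  intro p hp q hq k
  rw [Polynomial.coeff_mul]
  exact Submodule.sum_mem _ fun i _ ↦ Submodule.mul_mem_mul (hp _) (hq _)

theorem polyCoeffs_mono {J K : Submodule ℝ B} (h : J ≤ K) : polyCoeffs J ≤ polyCoeffs K :=
  fun _ hp k ↦ h (hp k)

theorem polyCoeffs_pow_le (J : Submodule ℝ B) (n : ℕ) :
    polyCoeffs J ^ (n + 1) ≤ polyCoeffs (J ^ (n + 1)) := by
  induction n with
  | zero => simp
  | succ n ih =>
    rw [pow_succ, pow_succ (n := n + 1)]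
    exact (mul_le_mul' ih le_rfl).trans (polyCoeffs_mul_le _ _)

theorem polyCoeffs_pow_eq_bot {n : ℕ} (hn : n ≠ 0) (h : J ^ n = ⊥) : polyCoeffs J ^ n = ⊥ := by
  obtain ⟨m, rfl⟩ := Nat.exists_eq_succ_of_ne_zero hn
  rw [eq_bot_iff]
  intro p hp
  rw [Submodule.mem_bot]
  ext k
  have := polyCoeffs_pow_le J m hp k
  rw [h, Submodule.mem_bot] at this
  simpa using this

end Ideal

open Polynomial in
/-- The commutator of `d/dt` with the multiplication by `a` is the multiplication by `a'`. -/
theorem adR_lmul_derivative {B : Type*} [Ring B] [Algebra ℝ B] (a : B[X]) :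
    adR (Algebra.lmul ℝ B[X] a) (derivative.restrictScalars ℝ) =
      Algebra.lmul ℝ B[X] (derivative a) := by
  ext1 p
  simp [adR_apply]

open Polynomial in
theorem foldl_adR_lmul_monomial {B : Type*} [Ring B] [Algebra ℝ B] (l : List B) (j : ℕ) (a : B) :
    (l.map fun v ↦ adR (Algebra.lmul ℝ B[X] (monomial 1 v))).foldl (fun u f => f u)
        (Algebra.lmul ℝ B[X] (monomial j a)) =
      Algebra.lmul ℝ B[X] (monomial (j + l.length)
        (l.foldl (fun u v => u * v - v * u) a)) := by
  induction l generalizing j a with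
  | nil => simp
  | cons b l ih =>
    rw [List.map_cons, List.foldl_cons, List.foldl_cons, List.length_cons, adR_apply, ← map_mul,
      ← map_mul, ← map_sub, monomial_mul_monomial, monomial_mul_monomial, add_comm 1 j,
      ← map_sub, ih, add_assoc, add_comm 1]

open Polynomial in
/-- The left-normed commutator of `d/dt` with the multiplications by `t v`, for `v` in a word `l`, is
the multiplication by `t ^ (|l| - 1)` times the left-normed commutator of `l`. -/
theorem foldl_adR_derivative {B : Type*} [Ring B] [Algebra ℝ B] (l : List B) (hl : l ≠ []) :
    (l.map fun v ↦ adR (Algebra.lmul ℝ B[X] (monomial 1 v))).foldl (fun u f => f u)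
        (derivative.restrictScalars ℝ) =
      Algebra.lmul ℝ B[X] (monomial (l.length - 1) (commWord l)) := by
  cases l with
  | nil => exact absurd rfl hl
  | cons a l =>
    rw [List.map_cons, List.foldl_cons, adR_lmul_derivative, derivative_monomial,
      foldl_adR_lmul_monomial]
    simp [commWord]

/-- The `m`-fold multiple of the homogeneous component of degree `m` of the Dynkin series, in an
associative algebra. -/
def dynkinSum {B : Type*} [Ring B] [Algebra ℝ B] (m : ℕ) (x y : B) : B :=
  ∑ k ∈ Finset.Icc 1 m, ∑ w ∈ BanachHomogeneousGroup.dynkinIndex m k,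
    ((-1 : ℝ) ^ (k - 1) / k * (∏ i, ((w i).1.factorial * (w i).2.factorial : ℝ))⁻¹) •
      commWord (blockWord w x y)

/-- For `m < N`, the words of total degree `m` in the expansion of `(exp Q exp P - 1) ^ k` are those
of the Dynkin series. -/
theorem filter_piFinset_expIndex {N m k : ℕ} (hm : m < N) :
    (Fintype.piFinset fun _ : Fin k ↦ expIndex N).filter
      (fun w ↦ ∑ i, ((w i).1 + (w i).2) = m) = BanachHomogeneousGroup.dynkinIndex m k := by
  ext w
  simp only [Finset.mem_filter, Fintype.mem_piFinset, expIndex, Finset.mem_product,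
    Finset.mem_range, BanachHomogeneousGroup.dynkinIndex]
  constructor
  · rintro ⟨h, hs⟩
    refine ⟨fun i ↦ ?_, fun i ↦ (h i).2, hs⟩
    have := Finset.single_le_sum (f := fun i ↦ (w i).1 + (w i).2) (fun _ _ ↦ Nat.zero_le _)
      (Finset.mem_univ i)
    omega
  · rintro ⟨h, h1, hs⟩
    refine ⟨fun i ↦ ⟨?_, h1 i⟩, hs⟩
    have := h i
    omega

theorem dynkinIndex_eq_empty {m k : ℕ} (h : m < k) :
    BanachHomogeneousGroup.dynkinIndex m k = ∅ := by
  rw [Finset.eq_empty_iff_forall_notMem]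
  intro w hw
  simp only [BanachHomogeneousGroup.dynkinIndex, Finset.mem_filter] at hw
  have : ∑ _i : Fin k, 1 ≤ ∑ i, ((w i).1 + (w i).2) := Finset.sum_le_sum fun i _ ↦ hw.2.1 i
  simp at this
  omega

section Formula

open Polynomial

variable {B : Type*} [Ring B] [Algebra ℝ B] {J : Submodule ℝ B} {n : ℕ} {x y : B}

/-- `log (exp (t x) exp (t y))`, as a polynomial in `t`. -/
def logExpMulExp (n : ℕ) (x y : B) : B[X] :=
  nlog n (nexp n (monomial 1 x) * nexp n (monomial 1 y))

theorem monomial_mem_polyCoeffs (hx : x ∈ J) (k : ℕ) : monomial k x ∈ polyCoeffs J := by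
  intro i
  rw [coeff_monomial]
  split_ifs
  exacts [hx, J.zero_mem]

/-- With `L a` the multiplication by `a` and `Z` the logarithm of `exp (t x) exp (t y)`,
the operator `adR (L Z)` is the logarithm of `exp (adR (L (t y))) exp (adR (L (t x)))`. Applied to
`d/dt`, this expresses `Z'` by left-normed commutators. -/
theorem derivative_logExpMulExp (hn : n ≠ 0) (hJ : J * J ≤ J) (hJn : J ^ n = ⊥) (hx : x ∈ J)
    (hy : y ∈ J) :
    derivative (logExpMulExp n x y) = ∑ k ∈ Finset.range (2 * n), ((-1 : ℝ) ^ (k - 1) / k) •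
      ∑ w ∈ Fintype.piFinset (fun _ : Fin k ↦ expIndex (2 * n)),
        ((∏ i, ((w i).1.factorial * (w i).2.factorial : ℝ))⁻¹) •
          monomial (∑ i, ((w i).1 + (w i).2) - 1) (commWord (blockWord w x y)) := by
  have hK : polyCoeffs J * polyCoeffs J ≤ polyCoeffs J :=
    (polyCoeffs_mul_le _ _).trans (polyCoeffs_mono hJ)
  have hKn := polyCoeffs_pow_eq_bot hn hJn
  have hX := monomial_mem_polyCoeffs hx 1
  have hY := monomial_mem_polyCoeffs hy 1
  have hU := pow_eq_zero_of_mem hKn (nexp_mul_nexp_sub_one_mem hK hn hX hY)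
  have hZ : logExpMulExp n x y ^ n = 0 := nlog_pow hU
  have hlm : ∀ {a : B[X]}, a ^ n = 0 → (Algebra.lmul ℝ B[X] a) ^ n = 0 := by
    intro a ha
    rw [← map_pow, ha, map_zero]
  have key := adR_eq_nlog (hlm (pow_eq_zero_of_mem hKn hX)) (hlm (pow_eq_zero_of_mem hKn hY))
    (hlm hZ) (by rw [← map_nexp, ← map_nexp, ← map_nexp, ← map_mul, logExpMulExp, nexp_nlog hU])
  have h1 := congrArg (fun T ↦ T (derivative.restrictScalars ℝ)) key
  simp only [adR_lmul_derivative] at h1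
  apply (Algebra.lmul_injective (R := ℝ) (A := B[X]))
  rw [h1, nlog, LinearMap.sum_apply, map_sum]
  refine Finset.sum_congr rfl fun k _ ↦ ?_
  rcases k with _ | k
  · simp
  rw [LinearMap.smul_apply, map_smul, exp_mul_exp_sub_one_pow_apply (by omega), map_sum]
  congr 1
  refine Finset.sum_congr rfl fun w hw ↦ ?_
  have hlen := length_blockWord w x y
  have hne : blockWord w x y ≠ [] := by
    intro h
    rw [h, List.length_nil] at hlen
    have h0 := (Finset.sum_eq_zero_iff.1 hlen.symm) 0 (Finset.mem_univ _)
    have := Fintype.mem_piFinset.1 hw 0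
    simp only [expIndex, Finset.mem_filter] at this
    omega
  rw [map_smul, ← hlen, ← foldl_adR_derivative _ hne, map_blockWord]

theorem coeff_logExpMulExp (hn : n ≠ 0) (hJ : J * J ≤ J) (hJn : J ^ n = ⊥) (hx : x ∈ J)
    (hy : y ∈ J) (m : ℕ) : (logExpMulExp n x y).coeff (m + 1) =
      if m + 1 < 2 * n then ((m + 1 : ℕ) : ℝ)⁻¹ • dynkinSum (m + 1) x y else 0 := by
  have h := congrArg (fun p ↦ p.coeff m) (derivative_logExpMulExp hn hJ hJn hx hy)
  simp only [coeff_derivative, finsetSum_coeff, coeff_smul, coeff_monomial] at h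
  have hz : (logExpMulExp n x y).coeff (m + 1) * ((m : B) + 1) =
      ((m + 1 : ℕ) : ℝ) • (logExpMulExp n x y).coeff (m + 1) := by
    rw [Nat.cast_smul_eq_nsmul, nsmul_eq_mul, (Nat.cast_commute (m + 1) _).eq]
    push_cast
    rfl
  rw [hz] at h
  have hm0 : ((m + 1 : ℕ) : ℝ) ≠ 0 := by positivity
  suffices h' : ((m + 1 : ℕ) : ℝ) • (logExpMulExp n x y).coeff (m + 1) =
      if m + 1 < 2 * n then dynkinSum (m + 1) x y else 0 by
    rw [← inv_smul_smul₀ hm0 ((logExpMulExp n x y).coeff (m + 1)), h']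
    split_ifs <;> simp
  rw [h]
  have hterm : ∀ (k : ℕ) (w : Fin k → ℕ × ℕ), w ∈ Fintype.piFinset (fun _ ↦ expIndex (2 * n)) →
      k ≠ 0 → (∑ i, ((w i).1 + (w i).2) - 1 = m ↔ ∑ i, ((w i).1 + (w i).2) = m + 1) := by
    intro k w hw hk
    have h1 := Fintype.mem_piFinset.1 hw ⟨0, Nat.pos_of_ne_zero hk⟩
    simp only [expIndex, Finset.mem_filter] at h1
    have := Finset.single_le_sum (f := fun i ↦ (w i).1 + (w i).2) (fun _ _ ↦ Nat.zero_le _)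
      (Finset.mem_univ (⟨0, Nat.pos_of_ne_zero hk⟩ : Fin k))
    omega
  split_ifs with hm
  · rw [dynkinSum]
    have hsub : Finset.Icc 1 (m + 1) ⊆ Finset.range (2 * n) := by
      intro k hk
      simp only [Finset.mem_Icc, Finset.mem_range] at hk ⊢
      omega
    rw [← Finset.sum_subset hsub]
    · refine Finset.sum_congr rfl fun k hk ↦ ?_
      have hk0 : k ≠ 0 := by simp only [Finset.mem_Icc] at hk; omega
      rw [← filter_piFinset_expIndex hm, Finset.sum_filter, Finset.smul_sum]
      refine Finset.sum_congr rfl fun w hw ↦ ?_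
      simp only [hterm k w hw hk0]
      split_ifs
      · rw [smul_smul]
      · simp
    · intro k hk1 hk2
      rcases eq_or_ne k 0 with rfl | hk0
      · simp
      have hk3 : m + 1 < k := by simp only [Finset.mem_Icc] at hk2; omega
      have he := (filter_piFinset_expIndex (k := k) hm).trans (dynkinIndex_eq_empty hk3)
      rw [Finset.sum_eq_zero, smul_zero]
      intro w hw
      rw [if_neg, smul_zero]
      rw [hterm k w hw hk0]
      intro hw'
      have : w ∈ (∅ : Finset (Fin k → ℕ × ℕ)) := he ▸ Finset.mem_filter.2 ⟨hw, hw'⟩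
      simp at this
  · refine Finset.sum_eq_zero fun k hk ↦ ?_
    rcases eq_or_ne k 0 with rfl | hk0
    · simp
    rw [Finset.sum_eq_zero, smul_zero]
    intro w hw
    split_ifs with hw'
    · rw [hterm k w hw hk0] at hw'
      have h1 := commWord_mem (J := J) (blockWord w x y) (fun a ha ↦ by
        rcases mem_blockWord ha with rfl | rfl <;> assumption)
      rw [length_blockWord, hw', show m + 1 = n + (m + 1 - n) by omega, pow_add, hJn,
        Submodule.bot_mul, Submodule.mem_bot] at h1
      rw [h1, smul_zero]
    · rw [smul_zero]

/-- **Dynkin's formula** for the logarithm of `exp x * exp y`, when `x` and `y` lie in a nilpotent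
non-unital subalgebra `J`. -/
theorem nlog_nexp_mul_nexp (hn : n ≠ 0) (hJ : J * J ≤ J) (hJn : J ^ n = ⊥) (hx : x ∈ J)
    (hy : y ∈ J) : nlog n (nexp n x * nexp n y) =
      ∑ m ∈ Finset.range (2 * n), (m : ℝ)⁻¹ • dynkinSum m x y := by
  -- evaluation of the polynomial at `t = 0` and `t = 1`
  have hev : ∀ c : B, (∀ b : B, Commute b c) → ∀ ev : B[X] →ₐ[ℝ] B,
      (∀ p, ev p = p.eval₂ (RingHom.id B) c) →
      ev (logExpMulExp n x y) = nlog n (nexp n (x * c) * nexp n (y * c)) := by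
    intro c hc ev hev
    rw [logExpMulExp, map_nlog, map_mul, map_nexp, map_nexp, hev, hev, eval₂_monomial,
      eval₂_monomial]
    simp
  have h0 := hev 0 (fun b ↦ Commute.zero_right b)
    (eval₂AlgHom (AlgHom.id ℝ B) 0 (fun b ↦ Commute.zero_right b)) (fun p ↦ rfl)
  have h1 := hev 1 (fun b ↦ Commute.one_right b)
    (eval₂AlgHom (AlgHom.id ℝ B) 1 (fun b ↦ Commute.one_right b)) (fun p ↦ rfl)
  change (logExpMulExp n x y).eval₂ (RingHom.id B) 0 = _ at h0
  change (logExpMulExp n x y).eval₂ (RingHom.id B) 1 = _ at h1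
  have hc0 : (logExpMulExp n x y).coeff 0 = 0 := by
    rw [eval₂_at_zero] at h0
    simpa [nexp_zero hn, nlog, zero_pow_eq] using h0
  rw [mul_one, mul_one] at h1
  have hc : ∀ m, (logExpMulExp n x y).coeff m =
      if m < 2 * n then (m : ℝ)⁻¹ • dynkinSum m x y else 0 := by
    intro m
    rcases m with _ | m
    · simp [hc0]
    · exact coeff_logExpMulExp hn hJ hJn hx hy m
  rw [← h1, eval₂_eq_sum_range' (n := max (2 * n) ((logExpMulExp n x y).natDegree + 1)) _ (by simp),
    ← Finset.sum_subset (Finset.range_subset_range.2 (le_max_left (2 * n)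
    ((logExpMulExp n x y).natDegree + 1)))]
  · refine Finset.sum_congr rfl fun m hm ↦ ?_
    rw [hc, if_pos (Finset.mem_range.1 hm)]
    simp
  · intro m _ hm
    rw [hc, if_neg (by simpa using hm)]
    simp

end Formula

end DynkinFormula

/-! ### The faithful nilpotent representation and the group laws -/

namespace BanachHomogeneousGroup

variable {M : Type*} [NormedAddCommGroup M] [NormedSpace ℝ M] (G : BanachHomogeneousGroup M)

section Layers

/-- The component `x ↦ x_{i+1}` as a continuous linear map. -/
def compL (i : Fin G.ι) : M →L[ℝ] M :=
  (G.layer (i + 1)).subtypeL ∘L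
    (ContinuousLinearMap.proj (R := ℝ) (φ := fun i : Fin G.ι ↦ G.layer (i + 1)) i) ∘L
      (G.sumEquiv.symm : M →L[ℝ] ((i : Fin G.ι) → G.layer (i + 1)))

@[simp]
theorem compL_apply (i : Fin G.ι) (x : M) : G.compL i x = G.comp i x := rfl

theorem comp_mem (i : Fin G.ι) (x : M) : G.comp i x ∈ G.layer (i + 1) := (G.sumEquiv.symm x i).2

theorem sum_comp (x : M) : ∑ i, G.comp i x = x := by
  conv_rhs => rw [← G.sumEquiv.apply_symm_apply x, G.sumEquiv_apply]
  rfl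

theorem comp_of_mem {i j : Fin G.ι} {x : M} (hx : x ∈ G.layer (j + 1)) :
    G.comp i x = if i = j then x else 0 := by
  have h : G.sumEquiv (Pi.single j ⟨x, hx⟩) = x := by
    rw [G.sumEquiv_apply, Finset.sum_eq_single j]
    · simp
    · intro k _ hk
      simp [Pi.single_eq_of_ne hk]
    · simp
  rw [comp, ← h, G.sumEquiv.symm_apply_apply, h]
  split_ifs with hij
  · subst hij; simp
  · simp [Pi.single_eq_of_ne hij]

theorem exists_eq_of_mem_layer {n : ℕ} {x : M} (hx : x ∈ G.layer n) :
    x = 0 ∨ ∃ j : Fin G.ι, (j : ℕ) + 1 = n := by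
  by_cases h : n = 0 ∨ G.ι < n
  · left
    rw [G.layer_eq_bot n h] at hx
    simpa using hx
  · right
    exact ⟨⟨n - 1, by omega⟩, by simp; omega⟩

/-- The operator acting on the layer `H_n` as multiplication by `c n`. -/
def weight (c : ℕ → ℝ) : M →L[ℝ] M := ∑ i : Fin G.ι, c (i + 1) • G.compL i

theorem weight_apply (c : ℕ → ℝ) (x : M) :
    G.weight c x = ∑ i : Fin G.ι, c (i + 1) • G.comp i x := by
  simp [weight]

theorem dil_eq_weight (r : ℝ) (x : M) : G.dil r x = G.weight (fun n ↦ r ^ n) x := by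
  rw [weight_apply, dil]

theorem weight_of_mem (c : ℕ → ℝ) {n : ℕ} {x : M} (hx : x ∈ G.layer n) :
    G.weight c x = c n • x := by
  rcases G.exists_eq_of_mem_layer hx with rfl | ⟨j, rfl⟩
  · simp
  · rw [weight_apply, Finset.sum_eq_single j]
    · simp [G.comp_of_mem hx]
    · intro i _ hi
      simp [G.comp_of_mem hx, hi]
    · simp

theorem comp_weight (c : ℕ → ℝ) (i : Fin G.ι) (x : M) :
    G.comp i (G.weight c x) = c (i + 1) • G.comp i x := by
  rw [weight_apply, ← compL_apply, map_sum, Finset.sum_eq_single i]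
  · simp [G.comp_of_mem (G.comp_mem i x)]
  · intro j _ hj
    simp [G.comp_of_mem (G.comp_mem j x), hj.symm]
  · simp

theorem ext_comp {x y : M} (h : ∀ i, G.comp i x = G.comp i y) : x = y := by
  rw [← G.sum_comp x, ← G.sum_comp y]
  exact Finset.sum_congr rfl fun i _ ↦ h i

theorem bracket_eq_sum (x y : M) :
    G.bracket x y = ∑ i, ∑ j, G.bracket (G.comp i x) (G.comp j y) := by
  conv_lhs => rw [← G.sum_comp x, ← G.sum_comp y]
  simp only [map_sum, sum_apply]
  exact Finset.sum_comm

/-- The Euler derivation `x ↦ ∑ i x_i`. -/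
def euler : M →L[ℝ] M := G.weight fun n ↦ n

/-- The inverse of the Euler derivation. -/
def eulerInv : M →L[ℝ] M := G.weight fun n ↦ (n : ℝ)⁻¹

theorem eulerInv_euler (x : M) : G.eulerInv (G.euler x) = x := by
  apply G.ext_comp
  intro i
  rw [eulerInv, comp_weight, euler, comp_weight, smul_smul, inv_mul_cancel₀, one_smul]
  positivity

theorem euler_bracket (x y : M) :
    G.euler (G.bracket x y) = G.bracket (G.euler x) y + G.bracket x (G.euler y) := by
  rw [G.bracket_eq_sum x y, G.bracket_eq_sum (G.euler x) y, G.bracket_eq_sum x (G.euler y),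
    map_sum, ← Finset.sum_add_distrib]
  refine Finset.sum_congr rfl fun i _ ↦ ?_
  rw [map_sum, ← Finset.sum_add_distrib]
  refine Finset.sum_congr rfl fun j _ ↦ ?_
  rw [euler, comp_weight, comp_weight,
    G.weight_of_mem _ (G.bracket_mem _ _ _ _ (G.comp_mem i x) (G.comp_mem j y))]
  simp [add_smul]

theorem dil_bracket (r : ℝ) (x y : M) :
    G.dil r (G.bracket x y) = G.bracket (G.dil r x) (G.dil r y) := by
  simp only [dil_eq_weight]
  rw [G.bracket_eq_sum x y, G.bracket_eq_sum (G.weight _ x), map_sum]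
  refine Finset.sum_congr rfl fun i _ ↦ ?_
  rw [map_sum]
  refine Finset.sum_congr rfl fun j _ ↦ ?_
  rw [comp_weight, comp_weight,
    G.weight_of_mem _ (G.bracket_mem _ _ _ _ (G.comp_mem i x) (G.comp_mem j y))]
  simp [pow_add, smul_smul, mul_comm]

/-- The filtration `H_k ⊕ H_{k+1} ⊕ ⋯`. -/
def filt (k : ℕ) : Submodule ℝ M where
  carrier := {x | ∀ i : Fin G.ι, (i : ℕ) + 1 < k → G.comp i x = 0}
  add_mem' {x y} hx hy i hi := by
    rw [← compL_apply, map_add, compL_apply, compL_apply, hx i hi, hy i hi, add_zero]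
  zero_mem' i _ := by rw [← compL_apply, map_zero]
  smul_mem' c x hx i hi := by rw [← compL_apply, map_smul, compL_apply, hx i hi, smul_zero]

theorem filt_anti {j k : ℕ} (h : j ≤ k) : G.filt k ≤ G.filt j := fun _ hx i hi ↦ hx i (by omega)

theorem mem_filt_one (x : M) : x ∈ G.filt 1 := fun i hi ↦ by omega

theorem mem_filt_of_mem_layer {k n : ℕ} (h : k ≤ n) {x : M} (hx : x ∈ G.layer n) :
    x ∈ G.filt k := by
  intro i hi
  rcases G.exists_eq_of_mem_layer hx with rfl | ⟨j, rfl⟩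
  · rw [← compL_apply, map_zero]
  · rw [G.comp_of_mem hx, if_neg]
    rintro rfl
    omega

theorem bracket_mem_filt {j k : ℕ} {x y : M} (hx : x ∈ G.filt j) (hy : y ∈ G.filt k) :
    G.bracket x y ∈ G.filt (j + k) := by
  rw [G.bracket_eq_sum]
  refine Submodule.sum_mem _ fun a _ ↦ Submodule.sum_mem _ fun b _ ↦ ?_
  by_cases ha : (a : ℕ) + 1 < j
  · simp [hx a ha]
  by_cases hb : (b : ℕ) + 1 < k
  · simp [hy b hb]
  exact G.mem_filt_of_mem_layer (by omega)
    (G.bracket_mem _ _ _ _ (G.comp_mem a x) (G.comp_mem b y))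

theorem eq_zero_of_mem_filt {k : ℕ} (hk : G.ι < k) {x : M} (hx : x ∈ G.filt k) : x = 0 := by
  apply G.ext_comp
  intro i
  rw [hx i (by omega), ← compL_apply, map_zero]

theorem foldl_bracket_mem_filt (l : List M) {k : ℕ} {x : M} (hx : x ∈ G.filt k) :
    l.foldl (fun u v => G.bracket u v) x ∈ G.filt (k + l.length) := by
  induction l generalizing k x with
  | nil => exact hx
  | cons a l ih =>
    have := ih (G.bracket_mem_filt hx (G.mem_filt_one a))
    rw [List.foldl_cons, List.length_cons]
    convert this using 2
    omega

theorem leftNormed_mem_filt (l : List M) : G.leftNormed l ∈ G.filt l.length := by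
  cases l with
  | nil => exact Submodule.zero_mem _
  | cons a l =>
    have := G.foldl_bracket_mem_filt l (G.mem_filt_one a)
    rwa [add_comm] at this

theorem dynkin_mem_filt (m : ℕ) (x y : M) : G.dynkin m x y ∈ G.filt m := by
  refine Submodule.sum_mem _ fun k _ ↦ Submodule.sum_mem _ fun w hw ↦ Submodule.smul_mem _ _ ?_
  have h := G.leftNormed_mem_filt (dynkinWord w x y)
  have hlen : (dynkinWord w x y).length = m :=
    (length_blockWord w x y).trans (Finset.mem_filter.1 hw).2.2
  rwa [hlen] at h

theorem dynkin_eq_zero {m : ℕ} (hm : G.ι < m) (x y : M) : G.dynkin m x y = 0 :=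
  G.eq_zero_of_mem_filt hm (G.dynkin_mem_filt m x y)

theorem dynkin_one (x y : M) : G.dynkin 1 x y = x + y := by
  have h : dynkinIndex 1 1 = {fun _ ↦ (1, 0), fun _ ↦ (0, 1)} := by
    ext w
    simp only [dynkinIndex, Finset.mem_filter, Fintype.mem_piFinset, Finset.mem_product,
      Finset.mem_range, Finset.mem_insert, Finset.mem_singleton, funext_iff, Fin.forall_fin_one,
      Finset.univ_unique, Finset.sum_singleton, Prod.ext_iff, Fin.default_eq_zero]
    omega
  rw [dynkin, Finset.Icc_self, Finset.sum_singleton, h, Finset.sum_pair]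
  · simp [dynkinWord, leftNormed]
  · intro h
    simpa using congrFun h 0

theorem comp_mul_of_zero {i : Fin G.ι} (hi : (i : ℕ) = 0) (x y : M) :
    G.comp i (G.mul x y) = G.comp i x + G.comp i y := by
  rw [mul, ← compL_apply, map_add, map_add, map_sum, Finset.sum_eq_zero]
  · simp
  · intro m hm
    exact G.dynkin_mem_filt m x y i (by simp at hm; omega)

end Layers

section Representation

/-- The faithful nilpotent representation of the Lie algebra `M` on `M × ℝ`: it is the restriction
to `M` of the adjoint representation of the semidirect product of `M` with the Euler derivation. -/
def rep : M →L[ℝ] (M × ℝ) →L[ℝ] (M × ℝ) :=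
  (ContinuousLinearMap.compL ℝ (M × ℝ) M (M × ℝ) (ContinuousLinearMap.inl ℝ M ℝ)) ∘L
    (((ContinuousLinearMap.compL ℝ (M × ℝ) M M).flip (ContinuousLinearMap.fst ℝ M ℝ)) ∘L G.bracket -
      (ContinuousLinearMap.smulRightL ℝ (M × ℝ) M (ContinuousLinearMap.snd ℝ M ℝ)) ∘L G.euler)

theorem rep_apply (x : M) (p : M × ℝ) :
    G.rep x p = (G.bracket x p.1 - p.2 • G.euler x, 0) := by
  simp [rep]

theorem rep_bracket (x y : M) :
    G.rep (G.bracket x y) = G.rep x * G.rep y - G.rep y * G.rep x := by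
  refine ContinuousLinearMap.ext fun p ↦ ?_
  have hj := G.jacobi x y p.1
  rw [G.bracket_skew y (G.bracket p.1 x), G.bracket_skew p.1 (G.bracket x y),
    G.bracket_skew p.1 x, map_neg, neg_apply, neg_neg,
    G.bracket_skew (G.bracket x p.1) y, ← sub_eq_add_neg, sub_eq_zero] at hj
  have he := G.euler_bracket x y
  rw [G.bracket_skew (G.euler x) y] at he
  simp only [rep_apply, sub_apply, mul_apply_eq_comp, map_sub,
    map_smul, zero_smul, sub_zero, Prod.mk_sub_mk, he, ← hj, smul_add, smul_neg]
  congr 1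
  abel

/-- The vectors of filtration degree at least `k` in `M × ℝ`, the second factor having degree `0`. -/
def repFilt (k : ℕ) : Submodule ℝ (M × ℝ) :=
  if k = 0 then ⊤ else (G.filt k).prod ⊥

theorem repFilt_anti (k : ℕ) : G.repFilt (k + 1) ≤ G.repFilt k := by
  rcases k with _ | k
  · simp [repFilt]
  · simp only [repFilt, Nat.succ_ne_zero, if_false]
    exact Submodule.prod_mono (G.filt_anti (by omega)) le_rfl

/-- The operators on `M × ℝ` that raise the filtration degree by `m`. -/
def raising (m : ℕ) : Submodule ℝ ((M × ℝ) →L[ℝ] (M × ℝ)) where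
  carrier := {T | ∀ k, ∀ p ∈ G.repFilt k, T p ∈ G.repFilt (k + m)}
  add_mem' hS hT k p hp := Submodule.add_mem _ (hS k p hp) (hT k p hp)
  zero_mem' _ _ _ := Submodule.zero_mem _
  smul_mem' c _ hT k p hp := Submodule.smul_mem _ c (hT k p hp)

theorem raising_mul_le (i j : ℕ) : G.raising i * G.raising j ≤ G.raising (i + j) := by
  rw [Submodule.mul_le]
  intro S hS T hT k p hp
  rw [add_comm i j, ← add_assoc]
  exact hS _ _ (hT k p hp)

theorem raising_one_mul_le : G.raising 1 * G.raising 1 ≤ G.raising 1 :=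
  (G.raising_mul_le 1 1).trans fun _ hT k p hp ↦ G.repFilt_anti _ (hT k p hp)

theorem raising_one_pow_le (m : ℕ) : G.raising 1 ^ (m + 1) ≤ G.raising (m + 1) :=
  pow_succ_le_of_mul_le G.raising G.raising_mul_le m

theorem raising_one_pow_eq_bot : G.raising 1 ^ (G.ι + 1) = ⊥ := by
  rw [eq_bot_iff]
  refine (G.raising_one_pow_le G.ι).trans fun T hT ↦ ?_
  rw [Submodule.mem_bot]
  refine ContinuousLinearMap.ext fun p ↦ ?_
  have h := hT 0 p (by simp [repFilt])
  simp only [repFilt, zero_add, Nat.succ_ne_zero, if_false, Submodule.mem_prod,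
    Submodule.mem_bot] at h
  exact Prod.ext (G.eq_zero_of_mem_filt (by omega) h.1) h.2

theorem rep_mem_raising (x : M) : G.rep x ∈ G.raising 1 := by
  intro k p hp
  rw [rep_apply]
  rcases k with _ | k
  · simpa [repFilt] using G.mem_filt_one _
  · simp only [repFilt, Nat.succ_ne_zero, if_false, Submodule.mem_prod, Submodule.mem_bot] at hp ⊢
    rw [hp.2, zero_smul, sub_zero]
    refine ⟨?_, trivial⟩
    have := G.bracket_mem_filt (G.mem_filt_one x) hp.1
    rwa [add_comm] at this

theorem rep_pow (x : M) : G.rep x ^ (G.ι + 1) = 0 :=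
  pow_eq_zero_of_mem G.raising_one_pow_eq_bot (G.rep_mem_raising x)

theorem rep_foldl (l : List M) (u : M) : G.rep (l.foldl (fun u v => G.bracket u v) u) =
    (l.map G.rep).foldl (fun u v => u * v - v * u) (G.rep u) := by
  induction l generalizing u with
  | nil => rfl
  | cons a l ih => rw [List.foldl_cons, ih, List.map_cons, List.foldl_cons, rep_bracket]

theorem rep_leftNormed (l : List M) : G.rep (G.leftNormed l) = commWord (l.map G.rep) := by
  cases l with
  | nil => simp [leftNormed, commWord]
  | cons a l => exact G.rep_foldl l a

theorem rep_dynkin (m : ℕ) (x y : M) :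
    G.rep (G.dynkin m x y) = (m : ℝ)⁻¹ • dynkinSum m (G.rep x) (G.rep y) := by
  rw [dynkin, dynkinSum, map_sum, Finset.smul_sum]
  refine Finset.sum_congr rfl fun k _ ↦ ?_
  rw [map_sum, Finset.smul_sum]
  refine Finset.sum_congr rfl fun w _ ↦ ?_
  rw [map_smul, rep_leftNormed, smul_smul, ← map_blockWord]
  congr 1
  ring

/-- The left inverse `T ↦ -E⁻¹ (T (0, 1))` of `rep`, where `E` is the Euler derivation. -/
def repInv : ((M × ℝ) →L[ℝ] (M × ℝ)) →L[ℝ] M :=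
  -(G.eulerInv ∘L ContinuousLinearMap.fst ℝ M ℝ ∘L
    ContinuousLinearMap.apply ℝ (M × ℝ) ((0, 1) : M × ℝ))

theorem repInv_rep (x : M) : G.repInv (G.rep x) = x := by
  simp [repInv, rep_apply, eulerInv_euler]

/-- The exponential of `rep x`. -/
def expRep (x : M) : (M × ℝ) →L[ℝ] (M × ℝ) := nexp (G.ι + 1) (G.rep x)

theorem nlog_expRep (x : M) : nlog (G.ι + 1) (G.expRep x) = G.rep x := nlog_nexp (G.rep_pow x)

theorem repInv_nlog_expRep (x : M) : G.repInv (nlog (G.ι + 1) (G.expRep x)) = x := by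
  rw [nlog_expRep, repInv_rep]

theorem expRep_injective : Function.Injective G.expRep := fun x y h ↦ by
  rw [← G.repInv_nlog_expRep x, h, repInv_nlog_expRep]

theorem rep_mul (x y : M) :
    G.rep (G.mul x y) = nlog (G.ι + 1) (G.expRep x * G.expRep y) := by
  rw [expRep, expRep, nlog_nexp_mul_nexp (J := G.raising 1) (Nat.succ_ne_zero _)
    G.raising_one_mul_le G.raising_one_pow_eq_bot (G.rep_mem_raising x) (G.rep_mem_raising y)]
  simp only [← rep_dynkin]
  rw [← map_sum]
  congr 1
  have hι := G.one_le_ι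
  rw [← Finset.sum_subset (s₁ := insert 1 (Finset.Icc 2 G.ι))]
  · rw [Finset.sum_insert (by simp), dynkin_one, mul]
  · intro m hm
    simp only [Finset.mem_insert, Finset.mem_Icc, Finset.mem_range] at hm ⊢
    omega
  · intro m _ hm
    simp only [Finset.mem_insert, Finset.mem_Icc, not_or, not_and, not_le] at hm
    rcases Nat.eq_zero_or_pos m with rfl | h0
    · simp [dynkin]
    · exact G.dynkin_eq_zero (hm.2 (by omega)) x y

theorem expRep_mul (x y : M) : G.expRep (G.mul x y) = G.expRep x * G.expRep y := by
  rw [expRep, rep_mul, nexp_nlog]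
  exact pow_eq_zero_of_mem G.raising_one_pow_eq_bot (nexp_mul_nexp_sub_one_mem
    G.raising_one_mul_le (Nat.succ_ne_zero _) (G.rep_mem_raising x) (G.rep_mem_raising y))

theorem expRep_zero : G.expRep 0 = 1 := by
  rw [expRep, map_zero, nexp_zero (Nat.succ_ne_zero _)]

theorem expRep_mul_expRep_neg (x : M) : G.expRep x * G.expRep (-x) = 1 := by
  rw [expRep, expRep, map_neg, nexp_mul_nexp_neg (G.rep_pow x)]

end Representation

section Group

theorem mul_assoc' (x y z : M) : G.mul (G.mul x y) z = G.mul x (G.mul y z) := by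
  apply G.expRep_injective
  simp only [expRep_mul, mul_assoc]

theorem mul_neg_self (x : M) : G.mul x (-x) = 0 := by
  apply G.expRep_injective
  rw [expRep_mul, expRep_mul_expRep_neg, expRep_zero]

theorem neg_mul_self (x : M) : G.mul (-x) x = 0 := by
  simpa using G.mul_neg_self (-x)

theorem zero_mul' (x : M) : G.mul 0 x = x := by
  apply G.expRep_injective
  rw [expRep_mul, expRep_zero, one_mul]

theorem neg_mul_mul_neg_mul (x y z : M) :
    G.mul (G.mul (-x) y) (G.mul (-y) z) = G.mul (-x) z := by
  rw [mul_assoc', ← G.mul_assoc' y, mul_neg_self, zero_mul']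

theorem mul_smul_smul (s t : ℝ) (x : M) : G.mul (s • x) (t • x) = (s + t) • x := by
  apply G.expRep_injective
  rw [expRep_mul, expRep, expRep, expRep, add_smul, map_add, nexp_add _ (G.rep_pow _) (G.rep_pow _)
    (by rw [← map_add, rep_pow])]
  rw [map_smul, map_smul]
  exact ((Commute.refl (G.rep x)).smul_left s).smul_right t

theorem dil_mul (r : ℝ) (x y : M) : G.dil r (G.mul x y) = G.mul (G.dil r x) (G.dil r y) := by
  have hl : ∀ l : List M, G.dil r (G.leftNormed l) = G.leftNormed (l.map (G.dil r)) := by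
    intro l
    cases l with
    | nil => rw [dil_eq_weight]; exact map_zero _
    | cons a l =>
      simp only [leftNormed, List.map_cons]
      induction l generalizing a with
      | nil => rfl
      | cons b l ih => rw [List.foldl_cons, ih, List.map_cons, List.foldl_cons, dil_bracket]
  have hd : ∀ m, G.dil r (G.dynkin m x y) = G.dynkin m (G.dil r x) (G.dil r y) := by
    intro m
    rw [dil_eq_weight, dynkin, dynkin, map_sum]
    refine Finset.sum_congr rfl fun k _ ↦ ?_
    rw [map_sum]
    refine Finset.sum_congr rfl fun w _ ↦ ?_
    rw [map_smul, ← dil_eq_weight, hl]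
    congr 2
    exact map_blockWord _ w x y
  rw [mul, mul, dil_eq_weight, map_add, map_add, map_sum]
  simp only [← dil_eq_weight, hd]

theorem continuous_expRep : Continuous G.expRep := by
  unfold expRep nexp
  fun_prop

theorem continuous_nlog {B : Type*} [NormedRing B] [NormedAlgebra ℝ B] (n : ℕ) :
    Continuous (nlog n : B → B) := by
  unfold nlog
  fun_prop

theorem continuous_mul' : Continuous fun p : M × M ↦ G.mul p.1 p.2 := by
  have h : ∀ p : M × M, G.mul p.1 p.2 =
      G.repInv (nlog (G.ι + 1) (G.expRep p.1 * G.expRep p.2)) := fun p ↦ by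
    rw [← expRep_mul, repInv_nlog_expRep]
  simp only [h]
  exact G.repInv.continuous.comp ((continuous_nlog _).comp
    ((G.continuous_expRep.comp continuous_fst).mul (G.continuous_expRep.comp continuous_snd)))

end Group

end BanachHomogeneousGroup

/-! ### Lipschitz maps of a real variable and density points -/

section LipschitzExtension

open Set Filter
open scoped NNReal

variable {E : Type*} [NormedAddCommGroup E]

/-- A Lipschitz map with values in a complete space extends to the closure of its domain. -/
theorem LipschitzOnWith.exists_extension_closure [CompleteSpace E] {K : ℝ≥0} {f : ℝ → E} {A : Set ℝ}
    (hf : LipschitzOnWith K f A) : ∃ g : ℝ → E, LipschitzOnWith K g (closure A) ∧ EqOn g f A := by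
  have hlim : ∀ x ∈ closure A, ∃ y, Tendsto f (𝓝[A] x) (𝓝 y) := by
    intro x hx
    have : (𝓝[A] x).NeBot := mem_closure_iff_nhdsWithin_neBot.1 hx
    have hc : Cauchy (map f (𝓝[A] x)) :=
      (cauchy_nhds.mono' this inf_le_left).map_of_le hf.uniformContinuousOn inf_le_right
    exact cauchy_iff_exists_le_nhds.1 hc
  have heq : EqOn (extendFrom A f) f A := fun x hx ↦
    extendFrom_eq (subset_closure hx) (hf.continuousOn x hx)
  refine ⟨extendFrom A f, LipschitzOnWith.closure (continuousOn_extendFrom le_rfl hlim) ?_, heq⟩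
  intro x hx y hy
  rw [heq hx, heq hy]
  exact hf hx hy

/-- A Lipschitz map on a closed set of real numbers that is unbounded in both directions extends
to the real line, by linear interpolation over the complementary intervals. -/
theorem LipschitzOnWith.exists_extension_of_isClosed [NormedSpace ℝ E]
    {K : ℝ≥0} {f : ℝ → E} {A : Set ℝ}
    (hA : IsClosed A) (hl : ∀ t, (A ∩ Iic t).Nonempty) (hr : ∀ t, (A ∩ Ici t).Nonempty)
    (hf : LipschitzOnWith K f A) : ∃ g : ℝ → E, LipschitzWith K g ∧ EqOn g f A := by
  have hd : ∀ s ∈ A, ∀ t ∈ A, s ≤ t → ‖f t - f s‖ ≤ K * (t - s) := by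
    intro s hs t ht hst
    have := hf.dist_le_mul t ht s hs
    rwa [dist_eq_norm, Real.dist_eq, abs_of_nonneg (by linarith)] at this
  have ha : ∀ t, ∃ a ∈ A, a ≤ t ∧ ∀ s ∈ A, s ≤ t → s ≤ a := by
    intro t
    have hb : BddAbove (A ∩ Iic t) := ⟨t, fun x hx ↦ hx.2⟩
    have hm := (hA.inter isClosed_Iic).csSup_mem (hl t) hb
    exact ⟨_, hm.1, hm.2, fun s hs hst ↦ le_csSup hb ⟨hs, hst⟩⟩
  have hb : ∀ t, ∃ b ∈ A, t ≤ b ∧ ∀ s ∈ A, t ≤ s → b ≤ s := by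
    intro t
    have hb : BddBelow (A ∩ Ici t) := ⟨t, fun x hx ↦ hx.2⟩
    have hm := (hA.inter isClosed_Ici).csInf_mem (hr t) hb
    exact ⟨_, hm.1, hm.2, fun s hs hst ↦ csInf_le hb ⟨hs, hst⟩⟩
  choose a haA hat hamax using ha
  choose b hbA htb hbmin using hb
  let g : ℝ → E := fun t ↦ f (a t) + ((t - a t) / (b t - a t)) • (f (b t) - f (a t))
  have hgA : EqOn g f A := by
    intro t ht
    have : a t = t := le_antisymm (hat t) (hamax t t ht le_rfl)
    simp [g, this]
  -- the increments of `g` inside one complementary interval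
  have hslope : ∀ t c, 0 ≤ c → ‖(c / (b t - a t)) • (f (b t) - f (a t))‖ ≤ K * c := by
    intro t c hc
    have hab : a t ≤ b t := (hat t).trans (htb t)
    rw [norm_smul, Real.norm_of_nonneg (div_nonneg hc (by linarith))]
    rcases hab.eq_or_lt with h | h
    · simp only [h, sub_self, div_zero, zero_mul]
      positivity
    · calc c / (b t - a t) * ‖f (b t) - f (a t)‖ ≤ c / (b t - a t) * (K * (b t - a t)) := by
            have := hd _ (haA t) _ (hbA t) hab
            have h0 : 0 ≤ c / (b t - a t) := div_nonneg hc (by linarith)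
            gcongr
        _ = K * c := by
            have : b t - a t ≠ 0 := by linarith
            field_simp
  have hleft : ∀ t, ‖g t - f (a t)‖ ≤ K * (t - a t) := by
    intro t
    simp only [g, add_sub_cancel_left]
    exact hslope t _ (by linarith [hat t])
  have hright : ∀ t, ‖f (b t) - g t‖ ≤ K * (b t - t) := by
    intro t
    have h : f (b t) - g t = ((b t - t) / (b t - a t)) • (f (b t) - f (a t)) := by
      rcases (((hat t).trans (htb t)).eq_or_lt) with h | h
      · simp [g, h]
      · have h0 : b t - a t ≠ 0 := by linarith
        have h1 : (b t - t) / (b t - a t) = 1 - (t - a t) / (b t - a t) := by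
          field_simp
          ring
        rw [h1, sub_smul, one_smul]
        simp only [g]
        abel
    rw [h]
    exact hslope t _ (by linarith [htb t])
  have hmain : ∀ s t, s ≤ t → ‖g t - g s‖ ≤ K * (t - s) := by
    intro s t hst
    rcases le_or_gt (b s) t with h | h
    · have h1 : b s ≤ a t := hamax t _ (hbA s) h
      calc ‖g t - g s‖ = ‖(g t - f (a t)) + (f (a t) - f (b s)) + (f (b s) - g s)‖ := by
            congr 1; abel
        _ ≤ ‖g t - f (a t)‖ + ‖f (a t) - f (b s)‖ + ‖f (b s) - g s‖ := norm_add₃_le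
        _ ≤ K * (t - a t) + K * (a t - b s) + K * (b s - s) :=
            add_le_add (add_le_add (hleft t) (hd _ (hbA s) _ (haA t) h1)) (hright s)
        _ = K * (t - s) := by ring
    · have h1 : a t = a s := by
        refine le_antisymm ?_ (hamax t _ (haA s) ((hat s).trans hst))
        by_contra hc
        have h2 : ¬ a t ≤ s := fun h2 ↦ hc (hamax s _ (haA t) h2)
        have := hbmin s _ (haA t) (by linarith)
        linarith [hat t]
      have h2 : b t = b s :=
        le_antisymm (hbmin t _ (hbA s) h.le) (hbmin s _ (hbA t) (hst.trans (htb t)))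
      have h3 : g t - g s = ((t - s) / (b s - a s)) • (f (b s) - f (a s)) := by
        simp only [g, h1, h2]
        rw [add_sub_add_left_eq_sub, ← sub_smul, ← sub_div]
        congr 2
        ring
      rw [h3]
      exact hslope s _ (by linarith)
  refine ⟨g, LipschitzWith.of_dist_le_mul fun s t ↦ ?_, hgA⟩
  rw [dist_eq_norm, Real.dist_eq]
  rcases le_total s t with h | h
  · rw [norm_sub_rev, abs_sub_comm, abs_of_nonneg (by linarith)]
    exact hmain s t h
  · rw [abs_of_nonneg (by linarith)]
    exact hmain t s h

/-- A Lipschitz map with values in a Banach space, defined on a bounded set of real numbers, extends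
to a Lipschitz map on the real line. -/
theorem LipschitzOnWith.exists_extension_of_isBounded [NormedSpace ℝ E] [CompleteSpace E]
    {K : ℝ≥0} {f : ℝ → E}
    {A : Set ℝ} {R : ℝ} (hA : A ⊆ Icc (-R) R) (hf : LipschitzOnWith K f A) :
    ∃ g : ℝ → E, LipschitzWith K g ∧ EqOn g f A := by
  classical
  rcases A.eq_empty_or_nonempty with rfl | ⟨s₀, hs₀⟩
  · exact ⟨0, LipschitzWith.of_dist_le_mul (by simp; intro x y; positivity), by simp⟩
  have hR : 0 ≤ R := by have := hA hs₀; linarith [this.1, this.2]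
  obtain ⟨g, hg, hgf⟩ := hf.exists_extension_closure
  have hcl : closure A ⊆ Icc (-R) R := closure_minimal hA isClosed_Icc
  -- far from `A` the extension is constant, which makes the domain unbounded in both directions
  let F : Set ℝ := Iic (-(3 * R) - 1) ∪ Ici (3 * R + 1)
  let h : ℝ → E := fun t ↦ if t ∈ closure A then g t else g s₀
  have hF : ∀ t ∈ F, t ∉ closure A := by
    rintro t (ht | ht) h'
    · have := (hcl h').1; simp only [mem_Iic] at ht; linarith
    · have := (hcl h').2; simp only [mem_Ici] at ht; linarith
  have hFd : ∀ t ∈ F, ∀ s ∈ closure A, dist s s₀ ≤ dist s t := by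
    intro t ht s hs
    have h1 := hcl hs
    have h2 := hA hs₀
    rw [Real.dist_eq, Real.dist_eq]
    refine (abs_le.2 ⟨by linarith [h1.1, h2.2], by linarith [h1.2, h2.1]⟩ :
      |s - s₀| ≤ 2 * R).trans ?_
    rcases ht with ht | ht
    · simp only [mem_Iic] at ht
      exact le_trans (by linarith [h1.1]) (le_abs_self _)
    · simp only [mem_Ici] at ht
      exact le_trans (by linarith [h1.2]) (neg_le_abs _)
  have hhF : ∀ t ∈ F, h t = g s₀ := fun t ht ↦ if_neg (hF t ht)
  have hhA : ∀ t ∈ closure A, h t = g t := fun t ht ↦ if_pos ht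
  have hs₀' := subset_closure hs₀
  have hmix : ∀ s ∈ closure A, ∀ t ∈ F, dist (h s) (h t) ≤ K * dist s t := by
    intro s hs t ht
    rw [hhA s hs, hhF t ht]
    exact (hg.dist_le_mul s hs s₀ hs₀').trans (by gcongr; exact hFd t ht s hs)
  have hh : LipschitzOnWith K h (closure A ∪ F) := by
    refine LipschitzOnWith.of_dist_le_mul ?_
    rintro s (hs | hs) t (ht | ht)
    · rw [hhA s hs, hhA t ht]
      exact hg.dist_le_mul s hs t ht
    · exact hmix s hs t ht
    · rw [dist_comm, dist_comm s]
      exact hmix t ht s hs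
    · rw [hhF s hs, hhF t ht, dist_self]
      positivity
  obtain ⟨G, hG, hGh⟩ := hh.exists_extension_of_isClosed
    (isClosed_closure.union (isClosed_Iic.union isClosed_Ici))
    (fun t ↦ ⟨min t (-(3 * R) - 1), Or.inr (Or.inl (min_le_right t _)), min_le_left t _⟩)
    (fun t ↦ ⟨max t (3 * R + 1), Or.inr (Or.inr (le_max_right t _)), le_max_left t _⟩)
  refine ⟨G, hG, fun t ht ↦ ?_⟩
  rw [hGh (Or.inl (subset_closure ht)), hhA t (subset_closure ht), hgf ht]

end LipschitzExtension

section RadonNikodym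

open Set Filter
open scoped NNReal ENNReal

variable {E : Type*} [NormedAddCommGroup E] [CompleteSpace E]

/-- The increments of a Lipschitz curve, stopped outside of `[-R, R]`, define a vector measure with
Lipschitz bound. -/
theorem LipschitzWith.exists_vectorMeasure {K : ℝ≥0} {f : ℝ → E} (hf : LipschitzWith K f) (R : ℝ) :
    ∃ ν : VectorMeasure ℝ E,
      (∀ u v, -R ≤ u → u ≤ v → v ≤ R → ν (Ioc u v) = f v - f u) ∧
      ∀ s, ‖ν s‖ₑ ≤ ((K : ℝ≥0∞) • volume.restrict (Ioc (-R) R)) s := by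
  let c : ℝ → ℝ := fun t ↦ max (-R) (min t R)
  let m := AddContent.onIoc (f ∘ c)
  have hc : Monotone c := fun s t h ↦ max_le_max le_rfl (min_le_min h le_rfl)
  have : IsFiniteMeasure ((K : ℝ≥0∞) • (volume.restrict (Ioc (-R) R) : Measure ℝ)) := by
    rw [← ENNReal.smul_def]; infer_instance
  have hbound : ∀ s ∈ {s : Set ℝ | ∃ u v, u ≤ v ∧ s = Ioc u v},
      ‖m s‖ₑ ≤ ((K : ℝ≥0∞) • volume.restrict (Ioc (-R) R)) s := by
    rintro s ⟨u, v, huv, rfl⟩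
    have hsub : Ioc (c u) (c v) ⊆ Ioc u v ∩ Ioc (-R) R := by
      rintro x ⟨hx1, hx2⟩
      simp only [c, max_lt_iff, le_max_iff, le_min_iff, min_lt_iff] at hx1 hx2
      simp only [mem_inter_iff, mem_Ioc]
      rcases hx2 with hx2 | ⟨h1, h2⟩
      · linarith
      · rcases hx1.2 with h3 | h3
        · exact ⟨⟨h3, h1⟩, hx1.1, h2⟩
        · linarith
    rw [AddContent.onIoc_apply huv, Measure.smul_apply, smul_eq_mul,
      Measure.restrict_apply measurableSet_Ioc, ← edist_eq_enorm_sub]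
    calc edist (f (c v)) (f (c u)) ≤ K * edist (c v) (c u) := hf _ _
      _ = K * volume (Ioc (c u) (c v)) := by
          rw [Real.volume_Ioc, edist_dist, Real.dist_eq, abs_of_nonneg (by linarith [hc huv])]
      _ ≤ K * volume (Ioc u v ∩ Ioc (-R) R) := by gcongr
  obtain ⟨ν, h1, h2⟩ :=
    VectorMeasure.exists_extension_of_isSetSemiring_of_le_measure_of_generateFrom
      IsSetSemiring.Ioc hbound (by
        refine (BorelSpace.measurable_eq (α := ℝ)).trans ?_
        rw [borel_eq_generateFrom_Ioc_le ℝ]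
        congr 1
        ext s
        simp only [mem_ofPred_eq]
        constructor
        · rintro ⟨l, u, h, rfl⟩; exact ⟨l, u, h, rfl⟩
        · rintro ⟨l, u, h, rfl⟩; exact ⟨l, u, h, rfl⟩)
  refine ⟨ν, fun u v hu huv hv ↦ ?_, h2⟩
  rw [h1 _ ⟨u, v, huv, rfl⟩, AddContent.onIoc_apply huv]
  simp [c, hv, hu, huv.trans hv, hu.trans huv]

/-- A Lipschitz curve in a Banach space with the Radon-Nikodym property is differentiable almost
everywhere. -/
theorem LipschitzWith.ae_differentiableAt_of_hasRNP [NormedSpace ℝ E] (hE : HasRNP E)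
    {K : ℝ≥0} {f : ℝ → E}
    (hf : LipschitzWith K f) : ∀ᵐ t, DifferentiableAt ℝ f t := by
  have key : ∀ n : ℕ, ∀ᵐ t : ℝ, t ∈ Ioo (-(n : ℝ)) n → DifferentiableAt ℝ f t := by
    intro n
    have hn : -(n : ℝ) ≤ n := by linarith [(Nat.cast_nonneg n : (0 : ℝ) ≤ n)]
    obtain ⟨ν, hν, hνle⟩ := hf.exists_vectorMeasure n
    obtain ⟨g, hg, hgν⟩ := hE ℝ (volume.restrict (Ioc (-(n : ℝ)) n)) ν
      ((VectorMeasure.variation_le_of_forall_enorm_le (fun s _ ↦ hνle s) univ).trans_lt (by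
        rw [Measure.smul_apply, smul_eq_mul]
        exact ENNReal.mul_lt_top (by simp) (by simp)))
      (fun s _ h0 ↦ by simpa [h0] using hνle s)
    have hgi : IntervalIntegrable g volume (-(n : ℝ)) n :=
      (intervalIntegrable_iff_integrableOn_Ioc_of_le hn).2 hg
    filter_upwards [hgi.ae_hasDerivAt_integral] with t ht htn
    rw [uIcc_of_le hn] at ht
    have hd := ht (Ioo_subset_Icc_self htn) (-(n : ℝ)) (left_mem_Icc.2 hn)
    have heq : (fun x ↦ ∫ t in (-(n : ℝ))..x, g t) =ᶠ[𝓝 t] fun x ↦ f x - f (-(n : ℝ)) := by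
      filter_upwards [Ioo_mem_nhds htn.1 htn.2] with x hx
      rw [← hν _ _ le_rfl hx.1.le hx.2.le, hgν _ measurableSet_Ioc,
        intervalIntegral.integral_of_le hx.1.le, Measure.restrict_restrict measurableSet_Ioc,
        inter_eq_left.2 (Ioc_subset_Ioc_right hx.2.le)]
    have := (heq.differentiableAt_iff.1 hd.differentiableAt).add_const (f (-(n : ℝ)))
    simpa using this
  filter_upwards [ae_all_iff.2 key] with t ht
  obtain ⟨n, hn⟩ := exists_nat_gt |t|
  exact ht n (abs_lt.1 hn)

/-- A Lipschitz map from an arbitrary set of real numbers to a Banach space with the Radon-Nikodym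
property is differentiable within that set almost everywhere. -/
theorem LipschitzOnWith.ae_differentiableWithinAt_of_hasRNP [NormedSpace ℝ E] (hE : HasRNP E)
    {K : ℝ≥0} {f : ℝ → E}
    {A : Set ℝ} (hf : LipschitzOnWith K f A) :
    ∀ᵐ t : ℝ, t ∈ A → DifferentiableWithinAt ℝ f A t := by
  have key : ∀ n : ℕ, ∀ᵐ t : ℝ, t ∈ A → t ∈ Ioo (-(n : ℝ)) n → DifferentiableWithinAt ℝ f A t := by
    intro n
    obtain ⟨g, hg, hgf⟩ :=
      (hf.mono (inter_subset_left (t := Icc (-(n : ℝ)) n))).exists_extension_of_isBounded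
        inter_subset_right
    filter_upwards [hg.ae_differentiableAt_of_hasRNP hE] with t ht htA htn
    have h1 := (ht.differentiableWithinAt (s := A ∩ Icc (-(n : ℝ)) n)).congr
      (fun x hx ↦ (hgf hx).symm) (hgf ⟨htA, Ioo_subset_Icc_self htn⟩).symm
    exact (differentiableWithinAt_inter (Icc_mem_nhds htn.1 htn.2)).1 h1
  filter_upwards [ae_all_iff.2 key] with t ht htA
  obtain ⟨n, hn⟩ := exists_nat_gt |t|
  exact ht n htA (abs_lt.1 hn)

end RadonNikodym

section Density

open Set Filter
open scoped ENNReal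

/-- Almost every point of a set of real numbers is a density point. -/
theorem ae_isDensityPoint (A : Set ℝ) : ∀ᵐ t : ℝ, t ∈ A → IsDensityPoint A t := by
  have h := Besicovitch.ae_tendsto_measure_inter_div (volume : Measure ℝ) A
  have hnull := nonpos_iff_eq_zero.1 ((Measure.le_restrict_apply _ _).trans_eq h)
  rw [ae_iff]
  refine measure_mono_null ?_ hnull
  intro t ht
  simp only [mem_ofPred_eq, Classical.not_imp] at ht
  refine ⟨fun hd ↦ ht.2 ?_, ht.1⟩
  refine hd.congr fun r ↦ ?_
  have h1 : volume (A ∩ Metric.closedBall t r) = volume (A ∩ Metric.ball t r) := by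
    refine le_antisymm ?_ (measure_mono (inter_subset_inter_right _ Metric.ball_subset_closedBall))
    have hsub : A ∩ Metric.closedBall t r ⊆ (A ∩ Metric.ball t r) ∪ {t - r, t + r} := by
      rintro x ⟨hxA, hx⟩
      rw [Metric.mem_closedBall, Real.dist_eq] at hx
      rcases hx.lt_or_eq with h | h
      · exact Or.inl ⟨hxA, by rwa [Metric.mem_ball, Real.dist_eq]⟩
      · right
        rcases abs_choice (x - t) with h' | h' <;> rw [h'] at h
        · right; simp only [mem_singleton_iff]; linarith
        · left; linarith
    refine (measure_mono hsub).trans ((measure_union_le _ _).trans ?_)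
    rw [(Set.toFinite {t - r, t + r}).measure_zero, add_zero]
  rw [h1, Real.volume_closedBall, Real.volume_ball]

/-- Near a density point `t` of `A`, every point `u` with `|u - t| ≤ r` is at distance `o(r)`
from `A`. -/
theorem IsDensityPoint.exists_mem_near {A : Set ℝ} {t : ℝ} (h : IsDensityPoint A t) {ε : ℝ}
    (hε : 0 < ε) : ∃ δ > 0, ∀ r, 0 < r → r < δ → ∀ u, |u - t| ≤ r → ∃ s ∈ A, |s - u| < ε * r := by
  wlog hε1 : ε ≤ 1 generalizing ε
  · obtain ⟨δ, hδ, H⟩ := this one_pos le_rfl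
    refine ⟨δ, hδ, fun r hr hrδ u hu ↦ ?_⟩
    obtain ⟨s, hs, hsu⟩ := H r hr hrδ u hu
    exact ⟨s, hs, hsu.trans (by nlinarith [not_le.1 hε1])⟩
  have hlt : ENNReal.ofReal (1 - ε / 2) < 1 := by
    rw [← ENNReal.ofReal_one]
    exact (ENNReal.ofReal_lt_ofReal_iff one_pos).2 (by linarith)
  have hev := h.eventually (lt_mem_nhds hlt)
  rw [eventually_nhdsWithin_iff, Metric.eventually_nhds_iff] at hev
  obtain ⟨δ, hδ, H⟩ := hev
  refine ⟨δ / 2, by linarith, fun r hr hrδ u hu ↦ ?_⟩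
  by_contra hcon
  push Not at hcon
  -- otherwise `A` misses the ball around `u`, which has the proportion `ε / 2` of `ball t (2 * r)`
  have h2r : (0 : ℝ) < 2 * r := by linarith
  have h1 := H (y := 2 * r) (by rw [Real.dist_eq, sub_zero, abs_of_pos h2r]; linarith) h2r
  rw [Real.volume_ball, ENNReal.lt_div_iff_mul_lt (Or.inl (by simpa using hr)) (Or.inl ENNReal.ofReal_ne_top)] at h1
  have hur := abs_le.1 hu
  have hsub : A ∩ Metric.ball t (2 * r) ⊆ Metric.ball t (2 * r) \ Metric.ball u (ε * r) := by
    rintro s ⟨hsA, hs⟩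
    refine ⟨hs, fun hs' ↦ ?_⟩
    rw [Metric.mem_ball, Real.dist_eq] at hs'
    linarith [hcon s hsA]
  have hball : Metric.ball u (ε * r) ⊆ Metric.ball t (2 * r) := by
    refine Metric.ball_subset_ball' ?_
    rw [Real.dist_eq]
    nlinarith
  have h2 := measure_mono (μ := volume) hsub
  rw [measure_sdiff hball measurableSet_ball.nullMeasurableSet measure_ball_lt_top.ne, Real.volume_ball,
    Real.volume_ball, ← ENNReal.ofReal_sub _ (by positivity)] at h2
  have h3 := h1.trans_le h2
  rw [← ENNReal.ofReal_mul (by linarith), ENNReal.ofReal_lt_ofReal_iff (by nlinarith)] at h3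
  nlinarith

end Density

/-! ### Estimates for long products and the homogeneous norm -/

section NormEstimates

variable {B : Type*} [NormedRing B]

theorem norm_pow_le_of_norm_one_le (h1 : ‖(1 : B)‖ ≤ 1) (a : B) (k : ℕ) : ‖a ^ k‖ ≤ ‖a‖ ^ k := by
  rcases k with _ | k
  · simpa using h1
  · exact norm_pow_le' a k.succ_pos

theorem norm_nexp_le [NormedAlgebra ℝ B] (h1 : ‖(1 : B)‖ ≤ 1) (n : ℕ) (a : B) :
    ‖nexp n a‖ ≤ Real.exp ‖a‖ := by
  refine (norm_sum_le _ _).trans (le_trans ?_ (Real.sum_le_exp_of_nonneg (norm_nonneg a) n))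
  refine Finset.sum_le_sum fun k _ ↦ ?_
  rw [norm_smul, norm_inv, Real.norm_natCast, div_eq_inv_mul]
  gcongr
  exact norm_pow_le_of_norm_one_le h1 a k

/-- The truncated exponential is Lipschitz on bounded sets. -/
theorem exists_norm_nexp_sub_nexp_le [NormedAlgebra ℝ B] (h1 : ‖(1 : B)‖ ≤ 1) (n : ℕ) (ρ : ℝ) :
    ∃ L, 0 ≤ L ∧
    ∀ a b : B, ‖a‖ ≤ ρ → ‖b‖ ≤ ρ → ‖nexp n a - nexp n b‖ ≤ L * ‖a - b‖ := by
  have hpow : ∀ k : ℕ, ∃ L, 0 ≤ L ∧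
      ∀ a b : B, ‖a‖ ≤ ρ → ‖b‖ ≤ ρ → ‖a ^ k - b ^ k‖ ≤ L * ‖a - b‖ := by
    intro k
    induction k with
    | zero => exact ⟨0, le_rfl, fun a b _ _ ↦ by simp⟩
    | succ k ih =>
      obtain ⟨L, hL, h⟩ := ih
      refine ⟨L * |ρ| + |ρ| ^ k, by positivity, fun a b ha hb ↦ ?_⟩
      have hρ := le_abs_self ρ
      calc ‖a ^ (k + 1) - b ^ (k + 1)‖ = ‖(a ^ k - b ^ k) * a + b ^ k * (a - b)‖ := by
            congr 1; rw [pow_succ, pow_succ]; noncomm_ring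
        _ ≤ ‖a ^ k - b ^ k‖ * ‖a‖ + ‖b ^ k‖ * ‖a - b‖ :=
            (norm_add_le _ _).trans (add_le_add (norm_mul_le _ _) (norm_mul_le _ _))
        _ ≤ L * ‖a - b‖ * |ρ| + |ρ| ^ k * ‖a - b‖ := by
            gcongr
            · exact h a b ha hb
            · exact ha.trans hρ
            · exact (norm_pow_le_of_norm_one_le h1 b k).trans
                (pow_le_pow_left₀ (norm_nonneg b) (hb.trans hρ) k)
        _ = (L * |ρ| + |ρ| ^ k) * ‖a - b‖ := by ring
  choose L hL h using hpow
  refine ⟨∑ k ∈ Finset.range n, ((k.factorial : ℝ)⁻¹) * L k,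
    Finset.sum_nonneg fun k _ ↦ mul_nonneg (by positivity) (hL k), fun a b ha hb ↦ ?_⟩
  rw [nexp, nexp, ← Finset.sum_sub_distrib, Finset.sum_mul]
  refine (norm_sum_le _ _).trans (Finset.sum_le_sum fun k _ ↦ ?_)
  rw [← smul_sub, norm_smul, norm_inv, Real.norm_natCast, mul_assoc]
  gcongr
  exact h k a b ha hb

/-- Two products of `m` factors of norm at most `q` whose factors are `e`-close. -/
theorem norm_prod_sub_prod_le {q e : ℝ} (hq : 1 ≤ q) {a b U V : ℕ → B} {m : ℕ}
    (hU : ∀ j < m, U (j + 1) = U j * a j) (hV : ∀ j < m, V (j + 1) = V j * b j)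
    (hUV : U 0 = V 0) (hV0 : ‖V 0‖ ≤ 1) (ha : ∀ j < m, ‖a j‖ ≤ q) (hb : ∀ j < m, ‖b j‖ ≤ q)
    (hab : ∀ j < m, ‖a j - b j‖ ≤ e) : ‖U m - V m‖ ≤ m * e * q ^ m := by
  have main : ∀ j ≤ m, ‖V j‖ ≤ q ^ j ∧ ‖U j - V j‖ ≤ j * e * q ^ j := by
    intro j hj
    induction j with
    | zero => simp [hUV, hV0]
    | succ j ih =>
      obtain ⟨h1, h2⟩ := ih (by omega)
      have hjm : j < m := by omega
      have he : 0 ≤ e := (norm_nonneg _).trans (hab j hjm)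
      refine ⟨?_, ?_⟩
      · rw [hV j hjm, pow_succ]
        exact (norm_mul_le _ _).trans (mul_le_mul h1 (hb j hjm) (norm_nonneg _) (by positivity))
      · calc ‖U (j + 1) - V (j + 1)‖ = ‖(U j - V j) * a j + V j * (a j - b j)‖ := by
              rw [hU j hjm, hV j hjm]; congr 1; noncomm_ring
          _ ≤ ‖U j - V j‖ * ‖a j‖ + ‖V j‖ * ‖a j - b j‖ :=
              (norm_add_le _ _).trans (add_le_add (norm_mul_le _ _) (norm_mul_le _ _))
          _ ≤ j * e * q ^ j * q + q ^ j * e := by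
              have := ha j hjm
              have := hab j hjm
              gcongr
          _ ≤ j * e * q ^ j * q + q ^ j * e * q := by
              have : 0 ≤ q ^ j * e := by positivity
              nlinarith
          _ = ((j + 1 : ℕ) : ℝ) * e * q ^ (j + 1) := by push_cast; ring
  exact (main m le_rfl).2

end NormEstimates

namespace BanachHomogeneousGroup

variable {M : Type*} [NormedAddCommGroup M] [NormedSpace ℝ M] (G : BanachHomogeneousGroup M)

section HomogeneousNorm

open Filter

theorem hnorm_term_le {σ : ℕ → ℝ} (x : M) (i : Fin G.ι) :
    σ (i + 1) * ‖G.comp i x‖ ^ (1 / ((i : ℝ) + 1)) ≤ G.hnorm σ x :=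
  le_ciSup (f := fun i : Fin G.ι ↦ σ (i + 1) * ‖G.comp i x‖ ^ (1 / ((i : ℝ) + 1)))
    (Set.finite_range _).bddAbove i

theorem norm_comp_le_of_hnorm_le {σ : ℕ → ℝ} (hσ : ∀ i, 1 ≤ i → i ≤ G.ι → 0 < σ i) {x : M} {c : ℝ}
    (h : G.hnorm σ x ≤ c) (i : Fin G.ι) :
    ‖G.comp i x‖ ≤ (c / σ (i + 1)) ^ ((i : ℕ) + 1) := by
  have hs : 0 < σ (i + 1) := hσ _ (by omega) (by omega)
  have h1 : ‖G.comp i x‖ ^ (1 / ((i : ℝ) + 1)) ≤ c / σ (i + 1) := by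
    rw [le_div_iff₀ hs, mul_comm]
    exact (G.hnorm_term_le x i).trans h
  have h2 := pow_le_pow_left₀ (by positivity) h1 ((i : ℕ) + 1)
  rwa [← Real.rpow_natCast (‖G.comp i x‖ ^ _), ← Real.rpow_mul (norm_nonneg _), Nat.cast_add,
    Nat.cast_one, one_div_mul_cancel (by positivity), Real.rpow_one] at h2

theorem hnorm_nonneg {σ : ℕ → ℝ} (hσ : ∀ i, 1 ≤ i → i ≤ G.ι → 0 < σ i) (x : M) :
    0 ≤ G.hnorm σ x :=
  Real.iSup_nonneg fun i ↦ mul_nonneg (hσ _ (by omega) (by omega)).le (by positivity)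

theorem hnorm_dil_le {σ : ℕ → ℝ} (hσ : ∀ i, 1 ≤ i → i ≤ G.ι → 0 < σ i) (r : ℝ) (x : M) :
    G.hnorm σ (G.dil r x) ≤ |r| * G.hnorm σ x := by
  refine Real.iSup_le (fun i ↦ ?_) (mul_nonneg (abs_nonneg r) (G.hnorm_nonneg hσ x))
  have h : ‖G.comp i (G.dil r x)‖ ^ (1 / ((i : ℝ) + 1)) =
      |r| * ‖G.comp i x‖ ^ (1 / ((i : ℝ) + 1)) := by
    rw [dil_eq_weight, comp_weight, norm_smul, norm_pow, Real.norm_eq_abs,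
      Real.mul_rpow (by positivity) (norm_nonneg _), ← Real.rpow_natCast,
      ← Real.rpow_mul (abs_nonneg r), Nat.cast_add, Nat.cast_one,
      mul_one_div_cancel (by positivity), Real.rpow_one]
  rw [h, mul_left_comm]
  gcongr
  exact G.hnorm_term_le x i

theorem tendsto_hnorm_zero {σ : ℕ → ℝ} (hσ : ∀ i, 1 ≤ i → i ≤ G.ι → 0 < σ i) :
    Tendsto (G.hnorm σ) (𝓝 0) (𝓝 0) := by
  have hle : ∀ x, G.hnorm σ x ≤ ∑ i : Fin G.ι, σ (i + 1) * ‖G.comp i x‖ ^ (1 / ((i : ℝ) + 1)) := by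
    intro x
    have hnn : ∀ i : Fin G.ι, 0 ≤ σ (i + 1) * ‖G.comp i x‖ ^ (1 / ((i : ℝ) + 1)) :=
      fun i ↦ mul_nonneg (hσ _ (by omega) (by omega)).le (by positivity)
    exact Real.iSup_le (fun i ↦ Finset.single_le_sum
      (f := fun i : Fin G.ι ↦ σ (i + 1) * ‖G.comp i x‖ ^ (1 / ((i : ℝ) + 1)))
      (fun i _ ↦ hnn i) (Finset.mem_univ i)) (Finset.sum_nonneg fun i _ ↦ hnn i)
  refine squeeze_zero (G.hnorm_nonneg hσ) hle ?_
  have hc : Continuous fun x ↦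
      ∑ i : Fin G.ι, σ (i + 1) * ‖G.comp i x‖ ^ (1 / ((i : ℝ) + 1)) := by
    refine continuous_finsetSum _ fun i _ ↦ continuous_const.mul ?_
    exact ((G.compL i).continuous.norm).rpow_const fun _ ↦ Or.inr (by positivity)
  have h0 := hc.tendsto 0
  convert h0 using 2
  symm
  refine Finset.sum_eq_zero fun i _ ↦ ?_
  rw [← compL_apply, map_zero, norm_zero, Real.zero_rpow (by positivity), mul_zero]

theorem hnorm_zero {σ : ℕ → ℝ} : G.hnorm σ 0 = 0 := by
  have h : ∀ i : Fin G.ι, σ (i + 1) * ‖G.comp i 0‖ ^ (1 / ((i : ℝ) + 1)) = 0 := fun i ↦ by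
    rw [← compL_apply, map_zero, norm_zero, Real.zero_rpow (by positivity), mul_zero]
  rw [hnorm, iSup_congr h, Real.iSup_const_zero]

theorem dil_dil_inv {r : ℝ} (hr : r ≠ 0) (x : M) : G.dil r (G.dil r⁻¹ x) = x := by
  apply G.ext_comp
  intro i
  simp only [dil_eq_weight, comp_weight]
  rw [smul_smul, ← mul_pow, mul_inv_cancel₀ hr, one_pow, one_smul]

theorem dil_of_mem_layer_one (r : ℝ) {v : M} (hv : v ∈ G.layer 1) : G.dil r v = r • v := by
  rw [dil_eq_weight, G.weight_of_mem _ hv, pow_one]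

theorem dil_neg (r : ℝ) (x : M) : G.dil r (-x) = -G.dil r x := by
  rw [dil_eq_weight, dil_eq_weight, map_neg]

theorem isHHom_smul {v : M} (hv : v ∈ G.layer 1) : G.IsHHom fun z : ℝ ↦ z • v where
  continuous := by fun_prop
  map_add s t := (G.mul_smul_smul s t v).symm
  map_dil r t _ := by rw [G.dil_of_mem_layer_one r (Submodule.smul_mem _ t hv), smul_smul]

end HomogeneousNorm

section Blowup

open Filter Set

/-- The index of the first layer. -/
def firstIdx : Fin G.ι := ⟨0, G.one_le_ι⟩

theorem exists_norm_expRep_sub_expRep_le (R : ℝ) : ∃ L, 0 ≤ L ∧ ∀ x y : M, ‖x‖ ≤ R → ‖y‖ ≤ R →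
    ‖G.expRep x - G.expRep y‖ ≤ L * ‖x - y‖ := by
  obtain ⟨L, hL, h⟩ := exists_norm_nexp_sub_nexp_le (B := (M × ℝ) →L[ℝ] (M × ℝ))
    ContinuousLinearMap.norm_id_le (G.ι + 1) (‖G.rep‖ * R)
  refine ⟨L * ‖G.rep‖, by positivity, fun x y hx hy ↦ ?_⟩
  have hb : ∀ x, ‖x‖ ≤ R → ‖G.rep x‖ ≤ ‖G.rep‖ * R := fun x hx ↦
    (G.rep.le_opNorm x).trans (by gcongr)
  refine (h _ _ (hb x hx) (hb y hy)).trans ?_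
  rw [← map_sub, mul_assoc]
  gcongr
  exact G.rep.le_opNorm _

theorem norm_expRep_le (x : M) : ‖G.expRep x‖ ≤ Real.exp (‖G.rep‖ * ‖x‖) :=
  (norm_nexp_le ContinuousLinearMap.norm_id_le _ _).trans
    (Real.exp_le_exp.2 (G.rep.le_opNorm x))

/-- A product of `N` elements of size `O(1/N)`, each of which is close to `v / N`, is close to `v`,
in exponential coordinates. -/
theorem exists_norm_expRep_sub_le (R : ℝ) : ∃ L, 0 ≤ L ∧ ∀ (N : ℕ) (v : M) (e : ℝ) (K k : ℕ → M),
    N ≠ 0 → ‖v‖ ≤ R → K 0 = 0 → (∀ j < N, K (j + 1) = G.mul (K j) (k j)) →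
    (∀ j < N, ‖k j‖ ≤ R / N) → (∀ j < N, ‖k j - (N : ℝ)⁻¹ • v‖ ≤ e) →
    ‖G.expRep (K N) - G.expRep v‖ ≤ L * (N * e) := by
  obtain ⟨L, hL, hLip⟩ := G.exists_norm_expRep_sub_expRep_le R
  refine ⟨L * Real.exp (‖G.rep‖ * R), by positivity, ?_⟩
  intro N v e K k hN hv hK0 hK hk hke
  have hNpos : (0 : ℝ) < N := by positivity
  have hN1 : (1 : ℝ) ≤ N := by exact_mod_cast Nat.one_le_iff_ne_zero.2 hN
  have hR : 0 ≤ R := (norm_nonneg v).trans hv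
  have hvN : ‖(N : ℝ)⁻¹ • v‖ ≤ R / N := by
    rw [norm_smul, norm_inv, Real.norm_natCast, div_eq_inv_mul]
    gcongr
  have hRN : R / N ≤ R := div_le_self hR hN1
  have hbd : ∀ x : M, ‖x‖ ≤ R / N → ‖G.expRep x‖ ≤ Real.exp (‖G.rep‖ * (R / N)) := fun x hx ↦
    (G.norm_expRep_le x).trans (Real.exp_le_exp.2 (by gcongr))
  have h := norm_prod_sub_prod_le (q := Real.exp (‖G.rep‖ * (R / N))) (e := L * e)
    (a := fun j ↦ G.expRep (k j)) (b := fun _ ↦ G.expRep ((N : ℝ)⁻¹ • v))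
    (U := fun j ↦ G.expRep (K j)) (V := fun j ↦ G.expRep ((j : ℝ) • (N : ℝ)⁻¹ • v)) (m := N)
    (Real.one_le_exp (by positivity))
    (fun j hj ↦ by simp only [hK j hj, expRep_mul])
    (fun j _ ↦ by
      rw [← expRep_mul]
      have := G.mul_smul_smul j 1 ((N : ℝ)⁻¹ • v)
      rw [one_smul] at this
      rw [this]
      push_cast
      rfl)
    (by simp [hK0])
    (by simp [expRep_zero])
    (fun j hj ↦ hbd _ (hk j hj)) (fun _ _ ↦ hbd _ hvN)
    (fun j hj ↦ (hLip _ _ ((hk j hj).trans hRN) (hvN.trans hRN)).trans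
      (by gcongr; exact hke j hj))
  simp only [smul_smul] at h
  rw [mul_inv_cancel₀ hNpos.ne', one_smul, ← Real.exp_nat_mul] at h
  refine h.trans (le_of_eq ?_)
  have : (N : ℝ) * (‖G.rep‖ * (R / N)) = ‖G.rep‖ * R := by field_simp
  rw [this]
  ring

end Blowup

end BanachHomogeneousGroup

/-! ### Blow-ups and Pansu differentiability -/

namespace BanachHomogeneousGroup

variable {M : Type*} [NormedAddCommGroup M] [NormedSpace ℝ M] (G : BanachHomogeneousGroup M)

section Blowup

open Filter Set

/-- If `A` comes close to every point at distance at most `|z|` from `t`, then it contains an almost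
equidistant chain from `t` to `t + z`. -/
theorem exists_chain {A : Set ℝ} {t z η : ℝ} {N : ℕ} (hN : N ≠ 0) (ht : t ∈ A) (hz : t + z ∈ A)
    (hη : 0 ≤ η) (h : ∀ u, |u - t| ≤ |z| → ∃ s ∈ A, |s - u| < η * |z|) :
    ∃ s : ℕ → ℝ, s 0 = t ∧ s N = t + z ∧
      ∀ j ≤ N, s j ∈ A ∧ |s j - (t + j / N * z)| ≤ η * |z| := by
  have hN0 : (N : ℝ) ≠ 0 := by exact_mod_cast hN
  have hex : ∀ j ≤ N, ∃ s ∈ A, |s - (t + j / N * z)| ≤ η * |z| := by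
    intro j hj
    obtain ⟨s, hs, hsu⟩ := h (t + j / N * z) (by
      rw [add_sub_cancel_left, abs_mul, abs_of_nonneg (by positivity)]
      refine mul_le_of_le_one_left (abs_nonneg z) (div_le_one_of_le₀ ?_ (by positivity))
      exact_mod_cast hj)
    exact ⟨s, hs, hsu.le⟩
  choose! s hsA hs using hex
  refine ⟨fun j ↦ if j = 0 then t else if j = N then t + z else s j, by simp, by simp [hN], ?_⟩
  intro j hj
  have h0 : 0 ≤ η * |z| := by positivity
  dsimp only
  split_ifs with h1 h2
  · subst h1
    exact ⟨ht, by simpa using h0⟩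
  · subst h2
    exact ⟨hz, by simpa [hN0] using h0⟩
  · exact ⟨hsA j hj, hs j hj⟩

variable {G}

/-- The dilation by `1/z` turns bounds of the homogeneous order `d^i` in layer `i`, with `d` at most
`N |z|`, into bounds of order `N^i`. -/
theorem norm_comp_dil_inv_le {z d D N : ℝ} (hz : z ≠ 0) (hD : 0 ≤ D) (hd0 : 0 ≤ d)
    (hd : d ≤ N * |z|) {h : M} {i : Fin G.ι} (hi : ‖G.comp i h‖ ≤ D * d ^ ((i : ℕ) + 1)) :
    ‖G.comp i (G.dil z⁻¹ h)‖ ≤ D * N ^ ((i : ℕ) + 1) := by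
  have hz' : 0 < |z| := abs_pos.2 hz
  rw [dil_eq_weight, comp_weight, norm_smul, norm_pow, norm_inv, Real.norm_eq_abs]
  calc |z|⁻¹ ^ ((i : ℕ) + 1) * ‖G.comp i h‖
      ≤ |z|⁻¹ ^ ((i : ℕ) + 1) * (D * (N * |z|) ^ ((i : ℕ) + 1)) := by
        gcongr
        exact hi.trans (by gcongr)
    _ = D * N ^ ((i : ℕ) + 1) := by
        rw [mul_left_comm, ← mul_pow, mul_comm N, inv_mul_cancel_left₀ hz'.ne']

theorem norm_le_of_norm_comp_le {x : M} {c : ℝ} (h : ∀ i, ‖G.comp i x‖ ≤ c) : ‖x‖ ≤ G.ι * c := by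
  rw [← G.sum_comp x]
  refine (norm_sum_le _ _).trans ((Finset.sum_le_sum fun i _ ↦ h i).trans ?_)
  simp

theorem norm_sub_le_of_norm_comp_le {x v : M} {c : ℝ} (hc : 0 ≤ c)
    (h : ∀ i : Fin G.ι, i ≠ G.firstIdx → ‖G.comp i x‖ ≤ c) :
    ‖x - v‖ ≤ ‖G.comp G.firstIdx x - v‖ + G.ι * c := by
  have h1 : x - v = (G.comp G.firstIdx x - v) + ∑ i ∈ Finset.univ.erase G.firstIdx, G.comp i x := by
    conv_lhs => rw [← G.sum_comp x, ← Finset.add_sum_erase _ _ (Finset.mem_univ G.firstIdx)]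
    abel
  rw [h1]
  refine (norm_add_le _ _).trans (add_le_add_right ?_ _)
  refine (norm_sum_le _ _).trans
    ((Finset.sum_le_sum fun i hi ↦ h i (Finset.ne_of_mem_erase hi)).trans ?_)
  rw [Finset.sum_const, nsmul_eq_mul]
  gcongr
  exact_mod_cast (Finset.card_le_univ _).trans (by simp)

theorem comp_firstIdx_neg_mul (x y : M) :
    G.comp G.firstIdx (G.mul (-x) y) = G.comp G.firstIdx y - G.comp G.firstIdx x := by
  rw [G.comp_mul_of_zero rfl, ← compL_apply, map_neg, compL_apply, neg_add_eq_sub]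

/-- Difference quotients of a differentiable map at points close to `t + p` and `t + q`. -/
theorem norm_increment_sub_le {f : ℝ → M} {t z η s u c : ℝ} {v : M} (hz : z ≠ 0)
    (hη : 0 ≤ η) (hs : ‖f s - f t - (s - t) • v‖ ≤ η * |s - t|)
    (hu : ‖f u - f t - (u - t) • v‖ ≤ η * |u - t|) (hst : |s - t| ≤ 2 * |z|)
    (hut : |u - t| ≤ 2 * |z|) (hus : |u - s - c * z| ≤ 2 * η * |z|) :
    ‖z⁻¹ • (f u - f s) - c • v‖ ≤ η * (2 * ‖v‖ + 4) := by
  have hz' : 0 < |z| := abs_pos.2 hz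
  have h1 : f u - f s - (c * z) • v =
      (f u - f t - (u - t) • v) - (f s - f t - (s - t) • v) + (u - s - c * z) • v := by
    simp only [sub_smul]
    abel
  have h2 : ‖f u - f s - (c * z) • v‖ ≤ η * (2 * ‖v‖ + 4) * |z| := by
    rw [h1]
    refine (norm_add_le _ _).trans ((add_le_add_left (norm_sub_le _ _) _).trans ?_)
    rw [norm_smul, Real.norm_eq_abs]
    have h3 : |u - s - c * z| * ‖v‖ ≤ 2 * η * |z| * ‖v‖ := by gcongr
    have h4 : η * |s - t| ≤ η * (2 * |z|) := by gcongr
    have h5 : η * |u - t| ≤ η * (2 * |z|) := by gcongr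
    linarith
  have h3 : z⁻¹ • (f u - f s) - c • v = z⁻¹ • (f u - f s - (c * z) • v) := by
    rw [smul_sub z⁻¹ _ ((c * z) • v), smul_smul, mul_comm c z, inv_mul_cancel_left₀ hz]
  rw [h3, norm_smul, norm_inv, Real.norm_eq_abs, inv_mul_le_iff₀ hz', mul_comm |z|]
  exact h2

/-- The blow-ups of a Lipschitz curve at a density point of its domain, at which the first layer of
the curve is differentiable, converge to the derivative of the first layer. -/
theorem norm_expRep_blowup_sub_le {A : Set ℝ} {γ : ℝ → M} {t D : ℝ} {v : M} (ht : t ∈ A)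
    (hA : IsDensityPoint A t) (hD : 0 ≤ D)
    (hγ : ∀ s ∈ A, ∀ u ∈ A, ∀ i : Fin G.ι,
      ‖G.comp i (G.mul (-γ s) (γ u))‖ ≤ D * |s - u| ^ ((i : ℕ) + 1))
    (hd : HasDerivWithinAt (fun s ↦ G.comp G.firstIdx (γ s)) v A t) {ε : ℝ} (hε : 0 < ε) :
    ∃ δ > 0, ∀ z, z ≠ 0 → |z| < δ → t + z ∈ A →
      ‖G.expRep (G.dil z⁻¹ (G.mul (-γ t) (γ (t + z)))) - G.expRep v‖ ≤ ε := by
  obtain ⟨L, hL, H⟩ := G.exists_norm_expRep_sub_le (max (2 * G.ι * D) ‖v‖)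
  -- the number `N` of links controls the contribution of the higher layers
  obtain ⟨N₀, hN₀⟩ := exists_nat_gt (8 * L * G.ι * D / ε)
  set N : ℕ := max N₀ 2 with hNdef
  have hN2 : (2 : ℝ) ≤ N := by exact_mod_cast le_max_right N₀ 2
  have hNpos : (0 : ℝ) < N := by linarith
  have hN0 : N ≠ 0 := by positivity
  have hNε : L * (4 * G.ι * D / N) ≤ ε / 2 := by
    have h1 : 8 * L * G.ι * D / ε < N := hN₀.trans_le (by exact_mod_cast le_max_left N₀ 2)
    rw [div_lt_iff₀ hε] at h1
    rw [mul_div_assoc', div_le_iff₀ hNpos]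
    nlinarith
  -- the error `η` in the choice of the chain and in the differentiability of the first layer
  set η : ℝ := min (1 / (2 * N)) (ε / (2 * (L * N * (2 * ‖v‖ + 4) + 1))) with hηdef
  have hηpos : 0 < η := by positivity
  have hη1 : η ≤ 1 / (2 * N) := min_le_left _ _
  have hη2 : η * (L * N * (2 * ‖v‖ + 4)) ≤ ε / 2 := by
    have h1 : η ≤ ε / (2 * (L * N * (2 * ‖v‖ + 4) + 1)) := min_le_right _ _
    rw [le_div_iff₀ (by positivity)] at h1
    nlinarith
  have hη3 : η ≤ 1 := hη1.trans (by rw [div_le_one (by positivity)]; linarith)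
  obtain ⟨δ₁, hδ₁, H₁⟩ := hA.exists_mem_near hηpos
  have hlo := (hasDerivWithinAt_iff_isLittleO.1 hd).def hηpos
  rw [eventually_nhdsWithin_iff, Metric.eventually_nhds_iff] at hlo
  obtain ⟨δ₂, hδ₂, H₂⟩ := hlo
  refine ⟨min δ₁ (δ₂ / 2), by positivity, fun z hz hzδ hzA ↦ ?_⟩
  have hz' : 0 < |z| := abs_pos.2 hz
  obtain ⟨s, hs0, hsN, hs⟩ := exists_chain hN0 ht hzA hηpos.le
    (H₁ |z| hz' (hzδ.trans_le (min_le_left _ _)))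
  have hst : ∀ j ≤ N, |s j - t| ≤ 2 * |z| := by
    intro j hj
    have h1 : |(j : ℝ) / N * z| ≤ |z| := by
      rw [abs_mul, abs_of_nonneg (by positivity)]
      refine mul_le_of_le_one_left (abs_nonneg z) (div_le_one_of_le₀ ?_ (by positivity))
      exact_mod_cast hj
    calc |s j - t| = |(s j - (t + j / N * z)) + j / N * z| := by congr 1; ring
      _ ≤ η * |z| + |z| := (abs_add_le _ _).trans (add_le_add (hs j hj).2 h1)
      _ ≤ 2 * |z| := by nlinarith
  have hder : ∀ j ≤ N, ‖G.comp G.firstIdx (γ (s j)) - G.comp G.firstIdx (γ t) - (s j - t) • v‖ ≤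
      η * |s j - t| := by
    intro j hj
    have h1 := H₂ (y := s j) (by
      rw [Real.dist_eq]
      have := hzδ.trans_le (min_le_right _ _)
      linarith [hst j hj]) (hs j hj).1
    simpa using h1
  have hstep : ∀ j < N, |s (j + 1) - s j - (N : ℝ)⁻¹ * z| ≤ 2 * η * |z| := by
    intro j hj
    have h1 := (hs j hj.le).2
    have h2 := (hs (j + 1) hj).2
    have h3 : s (j + 1) - s j - (N : ℝ)⁻¹ * z =
        (s (j + 1) - (t + ((j + 1 : ℕ) : ℝ) / N * z)) - (s j - (t + j / N * z)) := by
      push_cast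
      field_simp
      ring
    rw [h3]
    refine (abs_sub _ _).trans ?_
    linarith
  have hlen : ∀ j < N, |s j - s (j + 1)| ≤ 2 / N * |z| := by
    intro j hj
    rw [abs_sub_comm]
    have h1 : |(N : ℝ)⁻¹ * z| = (N : ℝ)⁻¹ * |z| := by
      rw [abs_mul, abs_of_nonneg (by positivity)]
    have h2 : 2 * η ≤ (N : ℝ)⁻¹ := by
      have : (N : ℝ)⁻¹ = 2 * (1 / (2 * N)) := by field_simp
      linarith
    calc |s (j + 1) - s j| = |(s (j + 1) - s j - (N : ℝ)⁻¹ * z) + (N : ℝ)⁻¹ * z| := by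
          congr 1; ring
      _ ≤ 2 * η * |z| + (N : ℝ)⁻¹ * |z| :=
          (abs_add_le _ _).trans (add_le_add (hstep j hj) h1.le)
      _ ≤ (N : ℝ)⁻¹ * |z| + (N : ℝ)⁻¹ * |z| := by gcongr
      _ = 2 / N * |z| := by ring
  have h2N : 2 / (N : ℝ) ≤ 1 := by rw [div_le_one hNpos]; exact hN2
  have hcomp : ∀ j < N, ∀ i : Fin G.ι,
      ‖G.comp i (G.dil z⁻¹ (G.mul (-γ (s j)) (γ (s (j + 1)))))‖ ≤ D * (2 / N) ^ ((i : ℕ) + 1) :=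
    fun j hj i ↦ norm_comp_dil_inv_le hz hD (abs_nonneg _) (hlen j hj)
      (hγ _ (hs j hj.le).1 _ (hs (j + 1) hj).1 i)
  have key := H N v (η * (2 * ‖v‖ + 4) + G.ι * (D * (2 / N) ^ 2))
    (fun j ↦ G.dil z⁻¹ (G.mul (-γ t) (γ (s j))))
    (fun j ↦ G.dil z⁻¹ (G.mul (-γ (s j)) (γ (s (j + 1))))) hN0 (le_max_right _ _)
    (by simp only [hs0, neg_mul_self, dil_eq_weight, map_zero])
    (fun j _ ↦ by simp only [← dil_mul, neg_mul_mul_neg_mul])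
    (fun j hj ↦ by
      have h1 := norm_le_of_norm_comp_le (G := G)
        (x := G.dil z⁻¹ (G.mul (-γ (s j)) (γ (s (j + 1))))) (c := D * (2 / N)) fun i ↦
          (hcomp j hj i).trans (by
            have := pow_le_of_le_one (by positivity) h2N (Nat.succ_ne_zero (i : ℕ))
            gcongr)
      refine h1.trans ?_
      rw [le_div_iff₀ hNpos]
      refine le_trans (le_of_eq ?_) (le_max_left _ _)
      field_simp)
    (fun j hj ↦ by
      refine (norm_sub_le_of_norm_comp_le (c := D * (2 / N) ^ 2) (by positivity)
        fun i hi ↦ (hcomp j hj i).trans ?_).trans (add_le_add_left ?_ _)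
      · have hi0 : (i : ℕ) ≠ 0 := fun h ↦ hi (Fin.ext h)
        have := pow_le_pow_of_le_one (by positivity) h2N (show 2 ≤ (i : ℕ) + 1 by omega)
        gcongr
      · have h1 : G.comp G.firstIdx (G.dil z⁻¹ (G.mul (-γ (s j)) (γ (s (j + 1))))) =
            z⁻¹ • (G.comp G.firstIdx (γ (s (j + 1))) - G.comp G.firstIdx (γ (s j))) := by
          rw [dil_eq_weight, comp_weight, comp_firstIdx_neg_mul]
          simp [firstIdx]
        rw [h1]
        exact norm_increment_sub_le (f := fun s ↦ G.comp G.firstIdx (γ s)) hz hηpos.le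
          (hder j hj.le) (hder (j + 1) hj) (hst j hj.le) (hst (j + 1) hj) (hstep j hj))
  rw [hsN] at key
  refine key.trans ?_
  have hfin : L * (N * (η * (2 * ‖v‖ + 4) + G.ι * (D * (2 / N) ^ 2))) =
      η * (L * N * (2 * ‖v‖ + 4)) + L * (4 * G.ι * D / N) := by
    field_simp
    ring
  rw [hfin]
  linarith

/-- The blow-ups converge in `M` itself, because the logarithm is a polynomial, hence continuous. -/
theorem tendsto_blowup {A : Set ℝ} {γ : ℝ → M} {t D : ℝ} {v : M} (ht : t ∈ A)
    (hA : IsDensityPoint A t) (hD : 0 ≤ D)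
    (hγ : ∀ s ∈ A, ∀ u ∈ A, ∀ i : Fin G.ι,
      ‖G.comp i (G.mul (-γ s) (γ u))‖ ≤ D * |s - u| ^ ((i : ℕ) + 1))
    (hd : HasDerivWithinAt (fun s ↦ G.comp G.firstIdx (γ s)) v A t) :
    Tendsto (fun z ↦ G.dil z⁻¹ (G.mul (-γ t) (γ (t + z)))) (𝓝[{z | t + z ∈ A} \ {0}] 0) (𝓝 v) := by
  have h1 : Tendsto (fun z ↦ G.expRep (G.dil z⁻¹ (G.mul (-γ t) (γ (t + z)))))
      (𝓝[{z | t + z ∈ A} \ {0}] 0) (𝓝 (G.expRep v)) := by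
    rw [Metric.tendsto_nhdsWithin_nhds]
    intro ε hε
    obtain ⟨δ, hδ, H⟩ := norm_expRep_blowup_sub_le ht hA hD hγ hd (half_pos hε)
    refine ⟨δ, hδ, fun z hz hzδ ↦ ?_⟩
    rw [Real.dist_eq, sub_zero] at hzδ
    rw [dist_eq_norm]
    exact (H z hz.2 hzδ hz.1).trans_lt (half_lt_self hε)
  have h2 := (G.repInv.continuous.comp (continuous_nlog (G.ι + 1))).tendsto (G.expRep v)
  have h3 := h2.comp h1
  simpa only [Function.comp_def, repInv_nlog_expRep] using h3

/-- Pansu differentiability follows from differentiability of the first layer: with `g` the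
increment `γ(t)⁻¹ γ(t + z)`, one has `g⁻¹ (z v) = δ_z ((δ_{1/z} g)⁻¹ v)`, where `δ_{1/z} g` tends
to `v`. -/
theorem pansuDifferentiableAt_of_hasDerivWithinAt {σ : ℕ → ℝ}
    (hσ : ∀ i, 1 ≤ i → i ≤ G.ι → 0 < σ i) {A : Set ℝ} {γ : ℝ → M} {t D : ℝ} {v : M} (ht : t ∈ A)
    (hA : IsDensityPoint A t) (hD : 0 ≤ D)
    (hγ : ∀ s ∈ A, ∀ u ∈ A, ∀ i : Fin G.ι,
      ‖G.comp i (G.mul (-γ s) (γ u))‖ ≤ D * |s - u| ^ ((i : ℕ) + 1)) (hv : v ∈ G.layer 1)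
    (hd : HasDerivWithinAt (fun s ↦ G.comp G.firstIdx (γ s)) v A t) :
    G.PansuDifferentiableAt σ A γ t := by
  refine ⟨ht, hA, fun z ↦ z • v, G.isHHom_smul hv, ?_⟩
  have h1 : Tendsto (fun z ↦ G.hnorm σ (G.mul (-G.dil z⁻¹ (G.mul (-γ t) (γ (t + z)))) v))
      (𝓝[{z | t + z ∈ A} \ {0}] 0) (𝓝 0) := by
    refine (G.tendsto_hnorm_zero hσ).comp ?_
    have h2 := (G.continuous_mul'.tendsto (-v, v)).comp
      ((tendsto_blowup ht hA hD hγ hd).neg.prodMk_nhds (tendsto_const_nhds (x := v)))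
    rwa [neg_mul_self] at h2
  rw [Asymptotics.isLittleO_iff]
  intro c hc
  have h2 := h1.eventually (gt_mem_nhds hc)
  rw [eventually_nhdsWithin_iff] at h2 ⊢
  filter_upwards [h2] with z hz hzA
  rw [Real.norm_eq_abs, Real.norm_eq_abs, rho, abs_of_nonneg (G.hnorm_nonneg hσ _)]
  rcases eq_or_ne z 0 with rfl | hz0
  · simp [neg_mul_self, zero_mul', hnorm_zero]
  · have h3 : G.mul (-G.mul (-γ t) (γ (t + z))) (z • v) =
        G.dil z (G.mul (-G.dil z⁻¹ (G.mul (-γ t) (γ (t + z)))) v) := by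
      rw [dil_mul, dil_neg, G.dil_dil_inv hz0, G.dil_of_mem_layer_one z hv]
    rw [h3, mul_comm c]
    refine (G.hnorm_dil_le hσ z _).trans ?_
    gcongr
    exact (hz ⟨hzA, hz0⟩).le

end Blowup

/-- The component in layer `i` of an increment of a Lipschitz curve has order `|s - t|^i`. -/
theorem exists_norm_comp_le {σ : ℕ → ℝ} (hσ : ∀ i, 1 ≤ i → i ≤ G.ι → 0 < σ i) {A : Set ℝ}
    {γ : ℝ → M} (hγ : ∃ C : ℝ, ∀ s ∈ A, ∀ t ∈ A, G.rho σ (γ s) (γ t) ≤ C * |s - t|) :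
    ∃ D : ℝ, 0 ≤ D ∧ ∀ s ∈ A, ∀ t ∈ A, ∀ i : Fin G.ι,
      ‖G.comp i (G.mul (-γ s) (γ t))‖ ≤ D * |s - t| ^ ((i : ℕ) + 1) := by
  obtain ⟨C, hC⟩ := hγ
  have hnn : ∀ i : Fin G.ι, 0 ≤ (|C| / σ (i + 1)) ^ ((i : ℕ) + 1) := fun i ↦
    pow_nonneg (div_nonneg (abs_nonneg C) (hσ _ (by omega) (by omega)).le) _
  refine ⟨∑ i : Fin G.ι, (|C| / σ (i + 1)) ^ ((i : ℕ) + 1), Finset.sum_nonneg fun i _ ↦ hnn i, ?_⟩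
  intro s hs t ht i
  have h1 : G.hnorm σ (G.mul (-γ s) (γ t)) ≤ |C| * |s - t| :=
    (hC s hs t ht).trans (by gcongr; exact le_abs_self C)
  refine (G.norm_comp_le_of_hnorm_le hσ h1 i).trans ?_
  rw [mul_div_right_comm, mul_pow]
  gcongr
  exact Finset.single_le_sum (f := fun i : Fin G.ι ↦ (|C| / σ (i + 1)) ^ ((i : ℕ) + 1))
    (fun i _ ↦ hnn i) (Finset.mem_univ i)

end BanachHomogeneousGroup

end

theorem theorem3p3 {M : Type*} [NormedAddCommGroup M] [NormedSpace ℝ M] [CompleteSpace M]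
    (G : BanachHomogeneousGroup M) (hRNP : HasRNP (G.layer 1))
    (σ : ℕ → ℝ) (hσ : ∀ i, 1 ≤ i → i ≤ G.ι → 0 < σ i) (hσ1 : σ 1 = 1)
    (A : Set ℝ) (γ : ℝ → M)
    (hγ : ∃ C : ℝ, ∀ s ∈ A, ∀ t ∈ A, G.rho σ (γ s) (γ t) ≤ C * |s - t|) :
    ∀ᵐ t ∂(volume : Measure ℝ), t ∈ A → G.PansuDifferentiableAt σ A γ t := by
  obtain ⟨D, hD, hcomp⟩ := G.exists_norm_comp_le hσ hγ
  have hcomplete : CompleteSpace (G.layer 1) := (G.isClosed_layer 1).completeSpace_coe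
  let f : ℝ → G.layer 1 := fun s ↦ ⟨G.comp G.firstIdx (γ s), G.comp_mem G.firstIdx (γ s)⟩
  have hf : LipschitzOnWith ⟨D, hD⟩ f A := by
    refine LipschitzOnWith.of_dist_le_mul fun s hs t ht ↦ ?_
    have h := hcomp s hs t ht G.firstIdx
    rw [BanachHomogeneousGroup.comp_firstIdx_neg_mul] at h
    rw [dist_comm, dist_eq_norm, Real.dist_eq]
    simp only [BanachHomogeneousGroup.firstIdx, zero_add, pow_one] at h
    exact h
  filter_upwards [hf.ae_differentiableWithinAt_of_hasRNP hRNP, ae_isDensityPoint A]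
    with t ht1 ht2 ht
  have hd := (G.layer 1).subtypeL.hasFDerivAt.comp_hasDerivWithinAt t (ht1 ht).hasDerivWithinAt
  exact BanachHomogeneousGroup.pansuDifferentiableAt_of_hasDerivWithinAt hσ ht (ht2 ht) hD hcomp
    (derivWithin f A t).2 hd
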